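/- Fix an integer $k\ge 1$. A (finite) $k$-tree is a graph obtained from $K_k$ by repeatedly adding a new vertex adjacent to exactly the vertices of some $k$-clique; it is nontrivial if it is not isomorphic to $K_k$. A $k$-leaf of a $k$-tree of order at least $k+1$ is a vertex of degree $k$, and a $k$-clique is simplicial if it contains a $k$-leaf. Path-type $k$-trees are the graphs obtained from $K_k$ or $K_{k+1}$ as follows: both are path-type, and if $P$ is path-type of order at least $k+1$, so is the graph obtained by joining a new vertex to exactly the vertices of a simplicial $k$-clique of $P$. Let $T$ be a $k$-tree and $C$ the vertex set of a $k$-clique of $T$. For $v\in V(T)\setminus C$ let $A_T(C,v)=(C,w_1,\dots,w_s,v)$ be the (unique) sequence with $w_i\in V(T)\setminus C$ such that the subgraph $P$ of $T$ induced by $C\cup\{w_1,\dots,w_s,v\}$ is a path-type $k$-tree having $C$ as a simplicial $k$-clique and $v$ as a $k$-leaf, and $(v,w_s,\dots,w_1)$ is a perfect elimination ordering of $P$ down to $C$, i.e. its entries together with $C$ exhaust $V(P)$ and each entry is a $k$-leaf of the graph left after deleting the earlier entries from $P$. For nontrivial $T$, the characteristic $1$-tree $T'_C$ is the union of the paths $C\,w_1\,w_2\cdots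 w_s\,v$ (in which $C$ is regarded as a single vertex) over all $k$-leaves $v$ of $T$ with $v\notin C$. For vertices $u,v$ of a graph $G$, a partial Kelmans operation on $G$ from $v$ to $u$ chooses a (possibly empty) set $W\subseteq N_G(v)\setminus(N_G(u)\cup\{u\})$ and replaces the edge $vw$ by the edge $uw$ for each $w\in W$. Two distinct $k$-cliques of $T$ are adjacent if they are contained in a common $(k+1)$-clique of $T$. **Lemma.** Let $T$ be a nontrivial $k$-tree, let $C_1$ and $C_2$ be two adjacent $k$-cliques of $T$, and let $c_2\in C_2\setminus C_1$. Then $C_1$ and $c_2$ are vertices of $T'_{C_1}$, and $T'_{C_2}$ is isomorphic to a tree obtained from $T'_{C_1}$ by some partial Kelmans operation from $c_2$ to $C_1$. -/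

import Mathlib

/-! Graphs are `G : SimpleGraph V` with `V` finite. A finset `S : Finset V` stands for the subgraph
`G[S]` of `G` induced by `S`; the graph `G` itself is `G[univ]`. -/

namespace KTree

section Defs

variable {V : Type*} [DecidableEq V]

/-- The induced subgraph `G[S]` is a `k`-tree: either it is a complete graph on `k` vertices, or it
arises from a `k`-tree by adding a new vertex `v` whose neighbours are exactly the vertices of some
`k`-clique `K`. -/
inductive IsKTreeOn (G : SimpleGraph V) (k : ℕ) : Finset V → Prop
  | base (S : Finset V) (hS : G.IsNClique k S) : IsKTreeOn G k S
  | step (S : Finset V) (v : V) (K : Finset V) (hS : IsKTreeOn G k S) (hv : v ∉ S)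
      (hKS : K ⊆ S) (hK : G.IsNClique k K) (hadj : ∀ w ∈ S, G.Adj v w ↔ w ∈ K) :
      IsKTreeOn G k (insert v S)

/-- The finite graph `G` is a `k`-tree. -/
def IsKTree [Fintype V] (G : SimpleGraph V) (k : ℕ) : Prop :=
  IsKTreeOn G k Finset.univ

/-- `v` is a `k`-leaf of the `k`-tree `G[S]` (of order at least `k + 1`): a vertex of degree `k`. -/
def IsKLeaf (G : SimpleGraph V) (k : ℕ) (S : Finset V) (v : V) : Prop :=
  IsKTreeOn G k S ∧ k + 1 ≤ S.card ∧ v ∈ S ∧ {w : V | w ∈ S ∧ G.Adj v w}.ncard = k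

/-- `K` is a simplicial `k`-clique of the `k`-tree `G[S]`: a `k`-clique containing a `k`-leaf. -/
def IsSimplicialClique (G : SimpleGraph V) (k : ℕ) (S K : Finset V) : Prop :=
  K ⊆ S ∧ G.IsNClique k K ∧ ∃ v ∈ K, IsKLeaf G k S v

/-- The induced subgraph `G[S]` is a path-type `k`-tree: it is `K_k` or `K_{k+1}`, or it arises
from a path-type `k`-tree of order at least `k + 1` by joining a new vertex `v` to (exactly) the
vertices of some simplicial `k`-clique `K`. -/
inductive IsPathType (G : SimpleGraph V) (k : ℕ) : Finset V → Prop
  | base (S : Finset V) (hS : G.IsNClique k S) : IsPathType G k S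
  | base_succ (S : Finset V) (hS : G.IsNClique (k + 1) S) : IsPathType G k S
  | step (S : Finset V) (v : V) (K : Finset V) (hS : IsPathType G k S) (hcard : k + 1 ≤ S.card)
      (hv : v ∉ S) (hK : IsSimplicialClique G k S K) (hadj : ∀ w ∈ S, G.Adj v w ↔ w ∈ K) :
      IsPathType G k (insert v S)

/-- The list `l` is a perfect elimination ordering of `G[S]` down to `C`: its entries together with
`C` exhaust `S`, and each entry is a `k`-leaf of what is left of `G[S]` after deleting the entries
before it. -/
def IsPerfectElim (G : SimpleGraph V) (k : ℕ) (S C : Finset V) (l : List V) : Prop :=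
  l.toFinset ∪ C = S ∧
    ∀ (i : ℕ) (hi : i < l.length), IsKLeaf G k (S \ (l.take i).toFinset) l[i]

/-- `(C, w₁, …, w_s, v)` with `ws = [w₁, …, w_s]` is the sequence `A(C, v)`: the graph induced by
`C ∪ {w₁, …, w_s, v}` is a path-type `k`-tree in which `C` is a simplicial `k`-clique and `v` is a
`k`-leaf, and `(v, w_s, …, w₁)` is a perfect elimination ordering of it down to `C`. -/
def IsASeq (G : SimpleGraph V) (k : ℕ) (C : Finset V) (v : V) (ws : List V) : Prop :=
  v ∉ C ∧ (∀ w ∈ ws, w ∉ C) ∧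
    IsPathType G k (C ∪ (ws ++ [v]).toFinset) ∧
    IsSimplicialClique G k (C ∪ (ws ++ [v]).toFinset) C ∧
    IsKLeaf G k (C ∪ (ws ++ [v]).toFinset) v ∧
    IsPerfectElim G k (C ∪ (ws ++ [v]).toFinset) C (v :: ws.reverse)

end Defs

/-- The graph whose vertices are the entries of the list `l` and whose edges join any two
consecutive entries of `l`; it is a path if the entries are distinct. -/
def listPath {X : Type*} (l : List X) : (⊤ : SimpleGraph X).Subgraph where
  verts := {a | a ∈ l}
  Adj a b := a ≠ b ∧ ([a, b] <:+: l ∨ [b, a] <:+: l)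
  adj_sub h := h.1
  edge_vert := by
    rintro a b ⟨-, h | h⟩
    · exact h.subset (by simp)
    · exact h.subset (by simp)
  symm := ⟨fun _ _ h => ⟨h.1.symm, h.2.symm⟩⟩

/-- The characteristic `1`-tree of the `k`-tree `G` with respect to the `k`-clique `C`: the union,
over all `k`-leaves `v` of `G` outside `C`, of the paths `C, w₁, …, w_s, v` given by the sequences
`A(C, v)`. Its vertices are `C` itself (as `Sum.inl C`) and vertices of `G` (as `Sum.inr w`). -/
def charTree {V : Type*} [Fintype V] [DecidableEq V] (G : SimpleGraph V) (k : ℕ) (C : Finset V) :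
    (⊤ : SimpleGraph (Finset V ⊕ V)).Subgraph :=
  ⨆ (v : V) (_ : IsKLeaf G k Finset.univ v ∧ v ∉ C) (ws : List V) (_ : IsASeq G k C v ws),
    listPath (Sum.inl C :: (ws ++ [v]).map Sum.inr)

/-- `G'` is obtained from `G` by a partial Kelmans operation from `v` to `u`: for some set `W` of
neighbours of `v` that are neither equal nor adjacent to `u`, the edge `vw` is replaced by the edge
`uw` for each `w ∈ W`. -/
def IsPartialKelmans {X : Type*} (G : SimpleGraph X) (v u : X) (G' : SimpleGraph X) : Prop :=
  ∃ W : Set X, W ⊆ G.neighborSet v \ insert u (G.neighborSet u) ∧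
    G' = G.deleteEdges {e | ∃ w ∈ W, e = s(v, w)} ⊔
      SimpleGraph.fromEdgeSet {e | ∃ w ∈ W, e = s(u, w)}

/-- Two `k`-cliques are adjacent: they are distinct and contained in a common `(k + 1)`-clique. -/
def AdjacentCliques {V : Type*} (G : SimpleGraph V) (k : ℕ) (C₁ C₂ : Finset V) : Prop :=
  G.IsNClique k C₁ ∧ G.IsNClique k C₂ ∧ C₁ ≠ C₂ ∧
    ∃ Q : Finset V, G.IsNClique (k + 1) Q ∧ C₁ ⊆ Q ∧ C₂ ⊆ Q

end KTree

/-! Build `T` from `C₁` one vertex at a time, recorded by a rank `r` that vanishes exactly on `C₁`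
(`IsOrder`). Each later vertex `v` has a `k`-clique `lower v` of earlier neighbours; its parent is
the root if `lower v = C₁`, and otherwise the highest-ranked element of `lower v`. The chain of
ancestors of `v`, read backwards, is the sequence A(C₁, v) (`IsChain.isASeq`, `isChain_of_isASeq`),
so the characteristic tree is the tree of this parent relation (`charTree_adj`, `charTree_isTree`).

As `c₂` is joined to all of `C₁`, it can be given rank 1 (`IsOrder.exists_rank_eq_one`), and C₂ = C₁
− d + c₂ for some d. Swapping the ranks of c₂ and d gives an order from C₂ in which every vertex
outside Q = C₁ ∪ {c₂} keeps its lower clique (`IsOrder.swap`, `IsOrder.lower_swap`). Identify C₂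
with c₂ and d with C₁ (`exchange`). If `lower v` is not inside Q, the parent of v is outside Q and
does not change. Otherwise `lower v` is Q minus one vertex. If that vertex is c₂, the parents in the
two trees are C₁ and d; if it is d, they are c₂ and C₂; in all other cases they are c₂ and d. Under
the identification only the last kind changes parent, from c₂ to C₁, and this is a partial Kelmans
operation (`IsOrder.parent_exchange`, `IsOrder.adj_exchange`). -/

set_option linter.unusedSectionVars false

namespace KTree

/-! ### Construction orders of a `k`-tree from a given clique. -/

section Order

open Classical in
/-- The neighbours of `v` in `S` of smaller rank. -/
noncomputable def lower {V : Type*} (G : SimpleGraph V) (S : Finset V) (r : V → ℕ) (v : V) : Finset V :=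
  S.filter fun w => G.Adj v w ∧ r w < r v

theorem mem_lower {V : Type*} {G : SimpleGraph V} {S : Finset V} {r : V → ℕ} {v w : V} :
    w ∈ lower G S r v ↔ w ∈ S ∧ G.Adj v w ∧ r w < r v := by
  simp [lower]

variable {V : Type*} [DecidableEq V] {G : SimpleGraph V} {k : ℕ} {S C : Finset V} {r : V → ℕ}

/-- The rank function `r` describes a construction of the `k`-tree `G[S]` from the `k`-clique `C`:
the vertices outside `C` are added in order of increasing rank, each joined to a `k`-clique. -/
structure IsOrder (G : SimpleGraph V) (k : ℕ) (S C : Finset V) (r : V → ℕ) : Prop where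
  sub : C ⊆ S
  root : G.IsNClique k C
  zero : ∀ v ∈ S, r v = 0 ↔ v ∈ C
  inj : ∀ v ∈ S, ∀ w ∈ S, r v = r w → v ∉ C → v = w
  clique : ∀ v ∈ S, v ∉ C → G.IsNClique k (lower G S r v)

theorem IsOrder.lower_eq_root (h : IsOrder G k S C r) {c : V} (hcS : c ∈ S) (hc : c ∉ C)
    (hadj : ∀ w ∈ C, G.Adj c w) : lower G S r c = C := by
  symm
  apply Finset.eq_of_subset_of_card_le
  · intro w hw
    have h0 := (h.zero w (h.sub hw)).2 hw
    have h1 := (h.zero c hcS).not.2 hc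
    exact mem_lower.2 ⟨h.sub hw, hadj w hw, by omega⟩
  · rw [(h.clique c hcS hc).card_eq, h.root.card_eq]

/-- A vertex joined to all of `C` can be made the first one. -/
theorem IsOrder.exists_rank_eq_one (h : IsOrder G k S C r) {c : V} (hcS : c ∈ S) (hc : c ∉ C)
    (hadj : ∀ w ∈ C, G.Adj c w) : ∃ r', IsOrder G k S C r' ∧ r' c = 1 := by
  classical
  have hl := h.lower_eq_root hcS hc hadj
  -- Rank 1 is freed by raising all other vertices outside `C`. No lower set changes: that of `c` is
  -- `C`, so the neighbours of `c` outside `C` were above it already.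
  let r' : V → ℕ := fun w => if w ∈ C then 0 else if w = c then 1 else r w + 1
  have hr0 : ∀ w ∈ C, r' w = 0 := fun w hw => by simp [r', hw]
  have hr1 : r' c = 1 := by simp [r', hc]
  have hr2 : ∀ w, w ∉ C → w ≠ c → r' w = r w + 1 := fun w hw hwc => by simp [r', hw, hwc]
  have hpos : ∀ w ∈ S, w ∉ C → 0 < r w := fun w hw hwC =>
    Nat.pos_of_ne_zero ((h.zero w hw).not.2 hwC)
  refine ⟨r', ⟨h.sub, h.root, ?_, ?_, ?_⟩, hr1⟩
  · intro v hv
    simp only [r']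
    split_ifs <;> simp_all
  · intro v hv w hw hvw hvC
    have hpv := hpos v hv hvC
    by_cases hwC : w ∈ C
    · rw [hr0 w hwC] at hvw
      by_cases hvc : v = c
      · subst hvc; omega
      · rw [hr2 v hvC hvc] at hvw; omega
    have hpw := hpos w hw hwC
    by_cases hvc : v = c <;> by_cases hwc : w = c
    · rw [hvc, hwc]
    · subst hvc; rw [hr1, hr2 w hwC hwc] at hvw; omega
    · subst hwc; rw [hr1, hr2 v hvC hvc] at hvw; omega
    · rw [hr2 v hvC hvc, hr2 w hwC hwc] at hvw
      exact h.inj v hv w hw (by omega) hvC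
  · intro v hv hvC
    have hpv := hpos v hv hvC
    suffices hs : lower G S r' v = lower G S r v by rw [hs]; exact h.clique v hv hvC
    ext w
    simp only [mem_lower, and_congr_right_iff]
    intro hw hvw
    by_cases hvc : v = c
    · subst hvc
      have : w ∈ lower G S r v ↔ w ∈ C := by rw [hl]
      simp only [mem_lower, hw, hvw, true_and] at this
      rw [this, hr1]
      by_cases hwC : w ∈ C
      · simp [hr0, hwC]
      · rw [hr2 w hwC hvw.ne']; simp [hwC]
    · rw [hr2 v hvC hvc]
      by_cases hwC : w ∈ C
      · rw [hr0 w hwC, (h.zero w hw).2 hwC]; simp [hpv]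
      by_cases hwc : w = c
      · subst hwc
        rw [hr1]
        have h1 : ¬ r v < r w := fun hlt =>
          hvC (by rw [← hl]; exact mem_lower.2 ⟨hv, hvw.symm, hlt⟩)
        have h2 : r v ≠ r w := fun he => hvc (h.inj v hv w hw he hvC)
        simp only [lt_add_iff_pos_left]
        constructor <;> intro <;> omega
      · rw [hr2 w hwC hwc]; omega

/-- The ranks of `d` and `c` are 0 and 1 while that of `v` is at least 2, so both stay below `v`
when they are swapped. -/
theorem IsOrder.lower_swap (h : IsOrder G k S C r) {c d : V} (hcS : c ∈ S) (hrc : r c = 1)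
    (hd : d ∈ C) {v : V} (hv : v ∈ S) (hvC : v ∉ C) (hvc : v ≠ c) :
    lower G S (r ∘ Equiv.swap c d) v = lower G S r v := by
  have hvd : v ≠ d := fun e => hvC (e ▸ hd)
  have h0 := (h.zero d (h.sub hd)).2 hd
  have h1 := (h.zero v hv).not.2 hvC
  have h2 : r v ≠ r c := fun e => hvc (h.inj v hv c hcS e hvC)
  ext w
  simp only [mem_lower, and_congr_right_iff, Function.comp, Equiv.swap_apply_of_ne_of_ne hvc hvd]
  intro hw hvw
  by_cases hwc : w = c
  · subst hwc
    rw [Equiv.swap_apply_left]; constructor <;> intro <;> omega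
  by_cases hwd : w = d
  · subst hwd
    rw [Equiv.swap_apply_right]; constructor <;> intro <;> omega
  rw [Equiv.swap_apply_of_ne_of_ne hwc hwd]

/-- The first vertex of an order can be exchanged for a vertex of the root clique. -/
theorem IsOrder.swap (h : IsOrder G k S C r) {c d : V} (hcS : c ∈ S) (hrc : r c = 1)
    (hadj : ∀ w ∈ C, G.Adj c w) (hd : d ∈ C) :
    IsOrder G k S (insert c (C.erase d)) (r ∘ Equiv.swap c d) := by
  have hc : c ∉ C := fun e => by have := (h.zero c hcS).2 e; omega
  have hdS := h.sub hd
  have h0 := (h.zero d hdS).2 hd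
  have hcd : c ≠ d := fun e => hc (e ▸ hd)
  have hroot : G.IsNClique k (insert c (C.erase d)) := by
    rw [SimpleGraph.isNClique_iff, Finset.card_insert_of_notMem (by simp [hc]),
      Finset.card_erase_add_one hd, h.root.card_eq]
    refine ⟨?_, rfl⟩
    rw [Finset.coe_insert, SimpleGraph.isClique_insert]
    refine ⟨h.root.isClique.subset (by simp), ?_⟩
    intro b hb _
    exact hadj b (Finset.mem_of_mem_erase hb)
  refine ⟨?_, hroot, ?_, ?_, ?_⟩
  · exact Finset.insert_subset hcS ((Finset.erase_subset _ _).trans h.sub)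
  · intro v hv
    by_cases hvc : v = c
    · subst hvc; simp [h0]
    by_cases hvd : v = d
    · subst hvd; simp [hrc, hcd.symm]
    simp [Equiv.swap_apply_of_ne_of_ne hvc hvd, hvc, hvd, h.zero v hv]
  · intro v hv w hw hvw hvC
    have hmem : ∀ x ∈ S, Equiv.swap c d x ∈ S := by
      intro x hx
      rw [Equiv.swap_apply_def]; split_ifs <;> assumption
    apply (Equiv.swap c d).injective
    apply h.inj _ (hmem v hv) _ (hmem w hw) hvw
    intro hm
    apply hvC
    by_cases hvc : v = c
    · simp [hvc]
    by_cases hvd : v = d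
    · subst hvd; rw [Equiv.swap_apply_right] at hm; exact (hc hm).elim
    rw [Equiv.swap_apply_of_ne_of_ne hvc hvd] at hm
    simp [hvd, hm]
  · intro v hv hvC
    simp only [Finset.mem_insert, Finset.mem_erase, not_or, not_and] at hvC
    by_cases hvd : v = d
    · subst hvd
      have : lower G S (r ∘ Equiv.swap c v) v = insert c (C.erase v) := by
        ext w
        simp only [mem_lower, Function.comp, Equiv.swap_apply_right, hrc, Finset.mem_insert,
          Finset.mem_erase, Nat.lt_one_iff]
        constructor
        · rintro ⟨hw, hvw, hlt⟩
          by_cases hwc : w = c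
          · exact Or.inl hwc
          rw [Equiv.swap_apply_of_ne_of_ne hwc hvw.ne'] at hlt
          exact Or.inr ⟨hvw.ne', (h.zero w hw).1 hlt⟩
        · rintro (rfl | ⟨hwv, hw⟩)
          · exact ⟨hcS, (hadj v hd).symm, by simp [h0]⟩
          · refine ⟨h.sub hw, h.root.isClique hd hw hwv.symm, ?_⟩
            rw [Equiv.swap_apply_of_ne_of_ne (fun e : w = c => hc (e ▸ hw)) hwv]
            exact (h.zero w (h.sub hw)).2 hw
      rw [this]
      exact hroot
    · have hvC' : v ∉ C := fun e => hvd (hvC.2 |> fun f => by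
        by_contra hne; exact f hne e)
      rw [h.lower_swap hcS hrc hd hv hvC' hvC.1]
      exact (h.clique v hv hvC' :)

/-- Two `k`-subsets of a set of size `k + 1` differ by the exchange of one element. -/
theorem exists_eq_insert_erase {C C' Q : Finset V} {c : V} (hC : C.card = k)
    (hC' : C'.card = k) (hQ : Q.card = k + 1) (hCQ : C ⊆ Q) (hCQ' : C' ⊆ Q) (hc : c ∈ C' \ C) :
    Q = insert c C ∧ ∃ d ∈ C, C' = insert c (C.erase d) := by
  rw [Finset.mem_sdiff] at hc
  have hQ' : Q = insert c C := by
    symm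
    apply Finset.eq_of_subset_of_card_le (Finset.insert_subset (hCQ' hc.1) hCQ)
    rw [Finset.card_insert_of_notMem hc.2]; omega
  refine ⟨hQ', ?_⟩
  obtain ⟨d, hd, hd'⟩ : ∃ d ∈ C, d ∉ C' := by
    by_contra! hsub
    exact hc.2 ((Finset.eq_of_subset_of_card_le hsub (by omega)).symm.subset hc.1)
  refine ⟨d, hd, ?_⟩
  apply Finset.eq_of_subset_of_card_le
  · intro x hx
    have := hCQ' hx
    rw [hQ', Finset.mem_insert] at this
    have hxd : x ≠ d := fun e => hd' (e ▸ hx)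
    simp only [Finset.mem_insert, Finset.mem_erase]
    tauto
  · rw [Finset.card_insert_of_notMem (by simp [hc.2]), Finset.card_erase_add_one hd]; omega

/-- A `k`-tree can be constructed from any of its `k`-cliques. -/
theorem IsKTreeOn.exists_order (hS : IsKTreeOn G k S) :
    ∀ C ⊆ S, G.IsNClique k C → ∃ r, IsOrder G k S C r := by
  induction hS with
  | base S hS =>
    intro C hCS hC
    have : C = S := Finset.eq_of_subset_of_card_le hCS (by rw [hC.card_eq, hS.card_eq])
    subst this
    exact ⟨fun _ => 0, subset_rfl, hC, fun v hv => by simp [hv], fun v hv w _ _ h => (h hv).elim,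
      fun v hv h => (h hv).elim⟩
  | step S v K hS hv hKS hK hadj ih =>
    -- For a clique that avoids `v`, the new vertex can come last.
    have ext : ∀ C ⊆ S, G.IsNClique k C → ∃ r, IsOrder G k (insert v S) C r := by
      intro C hCS hC
      obtain ⟨r, hr⟩ := ih C hCS hC
      let r' := Function.update r v (S.sup r + 1)
      have hrS : ∀ w ∈ S, r' w = r w := fun w hw =>
        Function.update_of_ne (fun e => hv (by rwa [← e])) _ _
      have hrv : r' v = S.sup r + 1 := Function.update_self ..
      have hle : ∀ w ∈ S, r w < S.sup r + 1 := fun w hw =>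
        Nat.lt_succ_of_le (Finset.le_sup (f := r) hw)
      refine ⟨r', hCS.trans (Finset.subset_insert _ _), hC, ?_, ?_, ?_⟩
      · intro w hw
        rcases Finset.mem_insert.1 hw with rfl | hw
        · rw [hrv]; simpa using fun e => hv (hCS e)
        · rw [hrS w hw]; exact hr.zero w hw
      · intro x hx y hy hxy hxC
        rcases Finset.mem_insert.1 hx with rfl | hx' <;> rcases Finset.mem_insert.1 hy with rfl | hy'
        · rfl
        · rw [hrv, hrS y hy'] at hxy; have := hle y hy'; omega
        · rw [hrv, hrS x hx'] at hxy; have := hle x hx'; omega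
        · rw [hrS x hx', hrS y hy'] at hxy; exact hr.inj x hx' y hy' hxy hxC
      · intro x hx hxC
        rcases Finset.mem_insert.1 hx with rfl | hx'
        · convert hK using 1
          ext w
          simp only [mem_lower, Finset.mem_insert]
          constructor
          · rintro ⟨rfl | hw, hxw, -⟩
            · exact (hxw.ne rfl).elim
            · exact (hadj w hw).1 hxw
          · intro hw
            refine ⟨Or.inr (hKS hw), (hadj w (hKS hw)).2 hw, ?_⟩
            rw [hrv, hrS w (hKS hw)]; exact hle w (hKS hw)
        · convert hr.clique x hx' hxC using 1
          ext w
          simp only [mem_lower, Finset.mem_insert, hrS x hx']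
          constructor
          · rintro ⟨rfl | hw, hxw, hlt⟩
            · rw [hrv] at hlt; have := hle x hx'; omega
            · rw [hrS w hw] at hlt; exact ⟨hw, hxw, hlt⟩
          · rintro ⟨hw, hxw, hlt⟩
            rw [← hrS w hw] at hlt
            exact ⟨Or.inr hw, hxw, hlt⟩
    intro C hCS hC
    -- If `v ∈ C`, then `C` lies in `insert v K`. Start from `K` instead, make `v` the first vertex
    -- and exchange it for the vertex `d` of `K` that `C` misses.
    by_cases hvC : v ∈ C
    · obtain ⟨r, hr⟩ := ext K hKS hK
      have hvK : v ∉ K := fun e => hv (hKS e)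
      have hadj' : ∀ w ∈ K, G.Adj v w := fun w hw => (hadj w (hKS hw)).2 hw
      obtain ⟨r', hr', h1⟩ := hr.exists_rank_eq_one (Finset.mem_insert_self v S) hvK hadj'
      have hCQ : C ⊆ insert v K := by
        intro w hw
        by_cases hwv : w = v
        · simp [hwv]
        have hwS : w ∈ S := Finset.mem_of_mem_insert_of_ne (hCS hw) hwv
        exact Finset.mem_insert_of_mem ((hadj w hwS).1 (hC.isClique hvC hw (Ne.symm hwv)))
      obtain ⟨-, d, hd, rfl⟩ := exists_eq_insert_erase hK.card_eq hC.card_eq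
        (by rw [Finset.card_insert_of_notMem hvK, hK.card_eq]) (Finset.subset_insert v K) hCQ
        (Finset.mem_sdiff.2 ⟨hvC, hvK⟩)
      exact ⟨_, hr'.swap (Finset.mem_insert_self v S) h1 hadj' hd⟩
    · exact ext C (fun w hw => Finset.mem_of_mem_insert_of_ne (hCS hw) (fun e => hvC (e ▸ hw))) hC

end Order

/-! ### Degrees and `k`-leaves. -/

section Degree

variable {V : Type*} [DecidableEq V] {G : SimpleGraph V} {k : ℕ} {S : Finset V}

open Classical in
/-- The neighbours of `v` in `S`. -/
noncomputable def nbrs {V : Type*} (G : SimpleGraph V) (S : Finset V) (v : V) : Finset V :=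
  S.filter (G.Adj v)

theorem mem_nbrs {V : Type*} {G : SimpleGraph V} {S : Finset V} {v w : V} :
    w ∈ nbrs G S v ↔ w ∈ S ∧ G.Adj v w := by
  simp [nbrs]

theorem isKLeaf_iff {v : V} : IsKLeaf G k S v ↔
    IsKTreeOn G k S ∧ k + 1 ≤ S.card ∧ v ∈ S ∧ (nbrs G S v).card = k := by
  have : {w : V | w ∈ S ∧ G.Adj v w} = (nbrs G S v : Set V) := by
    ext w; simp [mem_nbrs]
  rw [IsKLeaf, this, Set.ncard_coe_finset]

theorem nbrs_insert_of_adj {v w : V} (h : G.Adj w v) :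
    nbrs G (insert v S) w = insert v (nbrs G S w) := by
  ext x
  simp only [mem_nbrs, Finset.mem_insert]
  constructor
  · rintro ⟨rfl | hx, hwx⟩ <;> simp [*]
  · rintro (rfl | ⟨hx, hwx⟩) <;> simp [*]

theorem nbrs_insert_of_not_adj {v w : V} (h : ¬ G.Adj w v) :
    nbrs G (insert v S) w = nbrs G S w := by
  ext x
  simp only [mem_nbrs, Finset.mem_insert]
  constructor
  · rintro ⟨rfl | hx, hwx⟩
    · exact (h hwx).elim
    · exact ⟨hx, hwx⟩
  · rintro ⟨hx, hwx⟩; exact ⟨Or.inr hx, hwx⟩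

theorem nbrs_insert_self {v : V} {K : Finset V} (hKS : K ⊆ S)
    (hadj : ∀ w ∈ S, G.Adj v w ↔ w ∈ K) : nbrs G (insert v S) v = K := by
  ext w
  simp only [mem_nbrs, Finset.mem_insert]
  constructor
  · rintro ⟨rfl | hw, hvw⟩
    · exact (hvw.ne rfl).elim
    · exact (hadj w hw).1 hvw
  · intro hw
    exact ⟨Or.inr (hKS hw), (hadj w (hKS hw)).2 hw⟩

theorem nbrs_of_isClique {v : V} (hS : G.IsClique S) (hv : v ∈ S) : nbrs G S v = S.erase v := by
  ext x
  simp only [mem_nbrs, Finset.mem_erase]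
  constructor
  · rintro ⟨hx, h⟩; exact ⟨h.ne', hx⟩
  · rintro ⟨h, hx⟩; exact ⟨hx, hS hv hx h.symm⟩

/-- In a `k`-tree, a vertex has degree at least `k`, and the neighbours of a vertex of degree `k`
form a clique. -/
theorem IsKTreeOn.nbrs_spec (h : IsKTreeOn G k S) (hcard : k + 1 ≤ S.card) :
    ∀ v ∈ S, k ≤ (nbrs G S v).card ∧
      ((nbrs G S v).card = k → G.IsClique (nbrs G S v : Set V)) := by
  induction h with
  | base S hS => rw [hS.card_eq] at hcard; omega
  | step S v K hS hv hKS hK hadj ih =>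
    intro w hw
    rcases Finset.mem_insert.1 hw with rfl | hwS
    · rw [nbrs_insert_self hKS hadj]
      exact ⟨hK.card_eq.ge, fun _ => hK.isClique⟩
    have hadj' : G.Adj w v ↔ w ∈ K := by rw [G.adj_comm]; exact hadj w hwS
    have hvn : v ∉ nbrs G S w := fun e => hv (mem_nbrs.1 e).1
    by_cases hSk : k + 1 ≤ S.card
    · have hi := ih hSk w hwS
      -- A vertex of `K` had degree at least `k` and gains a neighbour, so the clause on degree `k`
      -- becomes vacuous for it.
      by_cases hwK : w ∈ K
      · rw [nbrs_insert_of_adj (hadj'.2 hwK), Finset.card_insert_of_notMem hvn]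
        exact ⟨by omega, by omega⟩
      · rw [nbrs_insert_of_not_adj (hadj'.not.2 hwK)]
        exact hi
    · have hSK : K = S := Finset.eq_of_subset_of_card_le hKS (by rw [hK.card_eq]; omega)
      subst hSK
      have hcl : G.IsNClique (k + 1) (insert v K) :=
        hK.insert fun b hb => (hadj b hb).2 hb
      rw [nbrs_of_isClique hcl.isClique hw, Finset.card_erase_of_mem hw, hcl.card_eq]
      exact ⟨le_rfl, fun _ => hcl.isClique.subset (by exact_mod_cast Finset.erase_subset _ _)⟩

theorem IsPathType.isKTreeOn (h : IsPathType G k S) : IsKTreeOn G k S := by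
  induction h with
  | base S hS => exact .base S hS
  | base_succ S hS =>
    have hne : S.Nonempty := Finset.card_pos.1 (by rw [hS.card_eq]; omega)
    obtain ⟨v, hv⟩ := hne
    have hcl : G.IsNClique k (S.erase v) :=
      ⟨hS.isClique.subset (by simp), by rw [Finset.card_erase_of_mem hv, hS.card_eq]; omega⟩
    rw [← Finset.insert_erase hv]
    refine .step _ v _ (.base _ hcl) (by simp) subset_rfl hcl fun w hw => ⟨fun _ => hw, fun _ => ?_⟩
    rw [Finset.mem_erase] at hw
    exact hS.isClique hv hw.2 hw.1.symm
  | step S v K hS hcard hv hK hadj ih => exact .step S v K ih hv hK.1 hK.2.1 hadj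

/-- A path-type `k`-tree of order at least `k + 2` has at most two `k`-leaves. -/
theorem IsPathType.exists_leaves (h : IsPathType G k S) (hcard : k + 2 ≤ S.card) :
    ∃ L : Finset V, L.card ≤ 2 ∧ ∀ v, IsKLeaf G k S v → v ∈ L := by
  induction h with
  | base S hS => rw [hS.card_eq] at hcard; omega
  | base_succ S hS => rw [hS.card_eq] at hcard; omega
  | step S v K hS hcS hv hK hadj ih =>
    obtain ⟨hKS, hKc, u, huK, hu⟩ := hK
    -- The vertices of `K` now have degree above `k`, so a surviving leaf is an old leaf outside
    -- `K`.
    have key : ∀ w, IsKLeaf G k (insert v S) w → w ≠ v → w ∉ K ∧ IsKLeaf G k S w := by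
      intro w hw hwv
      rw [isKLeaf_iff] at hw ⊢
      have hwS := Finset.mem_of_mem_insert_of_ne hw.2.2.1 hwv
      have hadj' : G.Adj w v ↔ w ∈ K := by rw [G.adj_comm]; exact hadj w hwS
      by_cases hwK : w ∈ K
      · have hvn : v ∉ nbrs G S w := fun e => hv (mem_nbrs.1 e).1
        have h1 := (hS.isKTreeOn.nbrs_spec hcS w hwS).1
        have h2 := hw.2.2.2
        rw [nbrs_insert_of_adj (hadj'.2 hwK), Finset.card_insert_of_notMem hvn] at h2
        omega
      · have h2 := hw.2.2.2
        rw [nbrs_insert_of_not_adj (hadj'.not.2 hwK)] at h2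
        exact ⟨hwK, hS.isKTreeOn, hcS, hwS, h2⟩
    -- The leaf `u ∈ K` uses up one of at most two old leaves. At order `k + 1` only one vertex lies
    -- outside `K` anyway.
    obtain ⟨M, hM, hM'⟩ : ∃ M : Finset V, M.card ≤ 1 ∧
        ∀ w, w ∉ K → IsKLeaf G k S w → w ∈ M := by
      by_cases hS2 : k + 2 ≤ S.card
      · obtain ⟨L, hL, hL'⟩ := ih hS2
        refine ⟨L.erase u, ?_, fun w hwK hw => ?_⟩
        · rw [Finset.card_erase_of_mem (hL' u hu)]; omega
        · exact Finset.mem_erase.2 ⟨fun e => hwK (e ▸ huK), hL' w hw⟩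
      · refine ⟨S \ K, ?_, fun w hwK hw => Finset.mem_sdiff.2 ⟨hw.2.2.1, hwK⟩⟩
        rw [Finset.card_sdiff_of_subset hKS, hKc.card_eq]; omega
    refine ⟨insert v M, (Finset.card_insert_le _ _).trans (by omega), fun w hw => ?_⟩
    by_cases hwv : w = v
    · simp [hwv]
    · exact Finset.mem_insert_of_mem (hM' w (key w hw hwv).1 (key w hw hwv).2)

end Degree

/-! ### Ancestor chains and the sequences A(C, v). -/

section Chain

variable {V : Type*} [DecidableEq V] [Fintype V] {G : SimpleGraph V} {k : ℕ} {C : Finset V}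
  {r : V → ℕ}

/-- `w` is the last of the vertices that `v` is joined to when it is added, and `w ∉ C`. -/
def IsParent (G : SimpleGraph V) (C : Finset V) (r : V → ℕ) (v w : V) : Prop :=
  w ∉ C ∧ w ∈ lower G Finset.univ r v ∧ ∀ u ∈ lower G Finset.univ r v, u ≠ w → r u < r w

/-- `l` is the list of the proper ancestors of `v`, from the parent of `v` on. -/
inductive IsChain (G : SimpleGraph V) (C : Finset V) (r : V → ℕ) : V → List V → Prop
  | root (v : V) (hv : v ∉ C) (h : lower G Finset.univ r v = C) : IsChain G C r v []
  | step (v w : V) (l : List V) (hv : v ∉ C) (h : IsParent G C r v w) (hl : IsChain G C r w l) :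
      IsChain G C r v (w :: l)

theorem IsParent.lt {v w : V} (h : IsParent G C r v w) : r w < r v := (mem_lower.1 h.2.1).2.2

theorem IsOrder.root_or_parent (h : IsOrder G k Finset.univ C r) {v : V} (hv : v ∉ C) :
    lower G Finset.univ r v = C ∨ ∃ w, IsParent G C r v w := by
  have hcl := h.clique v (Finset.mem_univ _) hv
  by_cases hsub : lower G Finset.univ r v ⊆ C
  · left
    exact Finset.eq_of_subset_of_card_le hsub (by rw [hcl.card_eq, h.root.card_eq])
  · right
    rw [Finset.not_subset] at hsub
    obtain ⟨x, hx, hxC⟩ := hsub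
    obtain ⟨w, hw, hmax⟩ := Finset.exists_max_image (lower G Finset.univ r v) r ⟨x, hx⟩
    have hwC : w ∉ C := by
      rw [← h.zero w (Finset.mem_univ _)]
      have := hmax x hx
      have := (h.zero x (Finset.mem_univ _)).not.2 hxC
      omega
    refine ⟨w, hwC, hw, fun u hu huw => ?_⟩
    rcases (hmax u hu).lt_or_eq with hlt | heq
    · exact hlt
    · exact (huw (h.inj w (Finset.mem_univ _) u (Finset.mem_univ _) heq.symm hwC).symm).elim

/-- The lower set of `v` is a clique with top element `w`, so its other elements are earlier
neighbours of `w`. This inheritance keeps lower sets inside chains. -/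
theorem IsOrder.lower_subset (h : IsOrder G k Finset.univ C r) {v w : V} (hv : v ∉ C)
    (hp : IsParent G C r v w) {x : V} (hx : x ∈ lower G Finset.univ r v) (hxw : x ≠ w) :
    x ∈ lower G Finset.univ r w :=
  mem_lower.2 ⟨Finset.mem_univ _,
    (h.clique v (Finset.mem_univ _) hv).isClique hp.2.1 hx hxw.symm, hp.2.2 x hx hxw⟩

theorem IsOrder.exists_chain (h : IsOrder G k Finset.univ C r) :
    ∀ (n : ℕ) (v : V), r v < n → v ∉ C → ∃ l, IsChain G C r v l := by
  intro n
  induction n with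
  | zero => intro v hv; omega
  | succ n ih =>
    intro v hvn hv
    rcases h.root_or_parent hv with h0 | ⟨w, hw⟩
    · exact ⟨[], .root v hv h0⟩
    · obtain ⟨l, hl⟩ := ih w (by have := hw.lt; omega) hw.1
      exact ⟨w :: l, .step v w l hv hw hl⟩

theorem IsChain.notMem {v : V} {l : List V} (h : IsChain G C r v l) : ∀ x ∈ v :: l, x ∉ C := by
  induction h with
  | root v hv h => simpa using hv
  | step v w l hv hp hl ih =>
    intro x hx
    rcases List.mem_cons.1 hx with rfl | hx
    · exact hv
    · exact ih x hx

theorem IsChain.lt {v : V} {l : List V} (h : IsChain G C r v l) : ∀ x ∈ l, r x < r v := by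
  induction h with
  | root v hv h => simp
  | step v w l hv hp hl ih =>
    intro x hx
    rcases List.mem_cons.1 hx with rfl | hx
    · exact hp.lt
    · exact (ih x hx).trans hp.lt

theorem IsChain.lower_subset (ho : IsOrder G k Finset.univ C r) {v : V} {l : List V}
    (h : IsChain G C r v l) : lower G Finset.univ r v ⊆ C ∪ l.toFinset := by
  induction h with
  | root v hv h => simp [h]
  | step v w l hv hp hl ih =>
    intro x hx
    by_cases hxw : x = w
    · simp [hxw]
    · have := ih (ho.lower_subset hv hp hx hxw)
      simp only [Finset.mem_union, List.toFinset_cons, Finset.mem_insert] at this ⊢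
      tauto

theorem IsChain.adj_iff (ho : IsOrder G k Finset.univ C r) {v : V} {l : List V}
    (h : IsChain G C r v l) :
    ∀ w ∈ C ∪ l.toFinset, G.Adj v w ↔ w ∈ lower G Finset.univ r v := by
  intro w hw
  rw [mem_lower]
  have hv : r v ≠ 0 := (ho.zero v (Finset.mem_univ _)).not.2 (h.notMem v (by simp))
  have : r w < r v := by
    rcases Finset.mem_union.1 hw with hw | hw
    · rw [(ho.zero w (Finset.mem_univ _)).2 hw]; omega
    · exact h.lt w (List.mem_toFinset.1 hw)
  simp [this]

theorem IsChain.notMem_tail {v : V} {l : List V} (h : IsChain G C r v l) :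
    v ∉ C ∪ l.toFinset := by
  rw [Finset.mem_union, List.mem_toFinset, not_or]
  exact ⟨h.notMem v (by simp), fun e => (h.lt v e).ne rfl⟩

theorem union_cons_toFinset (v : V) (l : List V) :
    C ∪ (v :: l).toFinset = insert v (C ∪ l.toFinset) := by
  rw [List.toFinset_cons, Finset.union_insert]

theorem IsChain.isKTreeOn (ho : IsOrder G k Finset.univ C r) {v : V} {l : List V}
    (h : IsChain G C r v l) : IsKTreeOn G k (C ∪ (v :: l).toFinset) := by
  have aux : ∀ {v : V} {l : List V}, IsChain G C r v l → IsKTreeOn G k (C ∪ l.toFinset) →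
      IsKTreeOn G k (C ∪ (v :: l).toFinset) := by
    intro v l h ht
    rw [union_cons_toFinset]
    exact .step _ v _ ht h.notMem_tail (h.lower_subset ho)
      (ho.clique v (Finset.mem_univ _) (h.notMem v (by simp))) (h.adj_iff ho)
  induction h with
  | root v hv h => exact aux (.root v hv h) (by simpa using .base C ho.root)
  | step v w l hv hp hl ih => exact aux (.step v w l hv hp hl) ih

theorem IsChain.isKLeaf (ho : IsOrder G k Finset.univ C r) {v : V} {l : List V}
    (h : IsChain G C r v l) : IsKLeaf G k (C ∪ (v :: l).toFinset) v := by
  rw [isKLeaf_iff]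
  refine ⟨h.isKTreeOn ho, ?_, by simp, ?_⟩
  · rw [union_cons_toFinset, Finset.card_insert_of_notMem h.notMem_tail, ← ho.root.card_eq]
    exact Nat.succ_le_succ (Finset.card_le_card Finset.subset_union_left)
  · rw [union_cons_toFinset, nbrs_insert_self (h.lower_subset ho) (h.adj_iff ho)]
    exact (ho.clique v (Finset.mem_univ _) (h.notMem v (by simp))).card_eq

theorem IsChain.isPathType (ho : IsOrder G k Finset.univ C r) {v : V} {l : List V}
    (h : IsChain G C r v l) : IsPathType G k (C ∪ (v :: l).toFinset) := by
  induction h with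
  | root v hv h =>
    rw [union_cons_toFinset]
    refine .base_succ _ ?_
    simp only [List.toFinset_nil, Finset.union_empty]
    exact ho.root.insert fun b hb => (mem_lower.1 (h ▸ hb)).2.1
  | step v w l hv hp hl ih =>
    have hc := IsChain.step v w l hv hp hl
    have hwl := hl.isKLeaf ho
    rw [union_cons_toFinset]
    exact .step _ v _ ih hwl.2.1 hc.notMem_tail
      ⟨hc.lower_subset ho, ho.clique v (Finset.mem_univ _) hv, w, hp.2.1, hwl⟩ (hc.adj_iff ho)

/-- The root clique keeps a vertex of degree `k` along a chain. -/
theorem IsChain.exists_root_leaf (ho : IsOrder G k Finset.univ C r) {v : V} {l : List V}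
    (h : IsChain G C r v l) :
    (l = [] ∧ ∀ c ∈ C, (nbrs G (C ∪ (v :: l).toFinset) c).card = k) ∨
      ∃ c ∈ C, c ∉ lower G Finset.univ r v ∧ (nbrs G (C ∪ (v :: l).toFinset) c).card = k := by
  induction h with
  | root v hv h =>
    left
    refine ⟨rfl, fun c hc => ?_⟩
    have hcl : G.IsNClique (k + 1) (insert v C) :=
      ho.root.insert fun b hb => (mem_lower.1 (h ▸ hb)).2.1
    have hcm : c ∈ insert v C := Finset.mem_insert_of_mem hc
    rw [union_cons_toFinset]
    simp only [List.toFinset_nil, Finset.union_empty]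
    rw [nbrs_of_isClique hcl.isClique hcm, Finset.card_erase_of_mem hcm, hcl.card_eq]
    rfl
  | step v w l hv hp hl ih =>
    right
    obtain ⟨c, hc, hcl, hck⟩ : ∃ c ∈ C, c ∉ lower G Finset.univ r v ∧
        (nbrs G (C ∪ (w :: l).toFinset) c).card = k := by
      rcases ih with ⟨-, hall⟩ | ⟨c, hc, hcl, hck⟩
      -- The second vertex of the chain has its parent outside `C` in its lower set, hence misses
      -- some `c ∈ C`. By inheritance all later vertices of the chain miss `c` too.
      · obtain ⟨c, hc, hcl⟩ : ∃ c ∈ C, c ∉ lower G Finset.univ r v := by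
          by_contra! hsub
          have := Finset.eq_of_subset_of_card_le hsub
            (by rw [(ho.clique v (Finset.mem_univ _) hv).card_eq, ho.root.card_eq])
          exact hp.1 (this ▸ hp.2.1)
        exact ⟨c, hc, hcl, hall c hc⟩
      · exact ⟨c, hc, fun e => hcl (ho.lower_subset hv hp e fun e => hp.1 (e ▸ hc)), hck⟩
    refine ⟨c, hc, hcl, ?_⟩
    rw [union_cons_toFinset, nbrs_insert_of_not_adj, hck]
    rw [G.adj_comm, (IsChain.step v w l hv hp hl).adj_iff ho c (Finset.mem_union_left _ hc)]
    exact hcl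

theorem IsChain.isSimplicialClique (hk : 1 ≤ k) (ho : IsOrder G k Finset.univ C r) {v : V}
    {l : List V} (h : IsChain G C r v l) :
    IsSimplicialClique G k (C ∪ (v :: l).toFinset) C := by
  obtain ⟨c, hc, hck⟩ : ∃ c ∈ C, (nbrs G (C ∪ (v :: l).toFinset) c).card = k := by
    rcases h.exists_root_leaf ho with ⟨-, hall⟩ | ⟨c, hc, -, hck⟩
    -- This is where `1 ≤ k` matters: `C` must have an element to serve as a leaf.
    · obtain ⟨c, hc⟩ := Finset.card_pos.1 (by rw [ho.root.card_eq]; omega : 0 < C.card)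
      exact ⟨c, hc, hall c hc⟩
    · exact ⟨c, hc, hck⟩
  exact ⟨Finset.subset_union_left, ho.root, c, hc,
    isKLeaf_iff.2 ⟨h.isKTreeOn ho, (h.isKLeaf ho).2.1, Finset.mem_union_left _ hc, hck⟩⟩

theorem IsPerfectElim.cons_iff {v : V} {l : List V} (hv : v ∉ C ∪ l.toFinset) :
    IsPerfectElim G k (C ∪ (v :: l).toFinset) C (v :: l) ↔
      IsKLeaf G k (C ∪ (v :: l).toFinset) v ∧ IsPerfectElim G k (C ∪ l.toFinset) C l := by
  have hs : ∀ i, (C ∪ (v :: l).toFinset) \ ((v :: l).take (i + 1)).toFinset =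
      (C ∪ l.toFinset) \ (l.take i).toFinset := by
    intro i
    rw [List.take_succ_cons, union_cons_toFinset, List.toFinset_cons]
    ext x
    simp only [Finset.mem_sdiff, Finset.mem_insert, not_or]
    constructor
    · tauto
    · rintro ⟨h1, h2⟩
      exact ⟨Or.inr h1, fun e => hv (e ▸ h1), h2⟩
  unfold IsPerfectElim
  constructor
  · rintro ⟨-, h⟩
    have h0 := h 0 (by simp)
    rw [List.take_zero, List.toFinset_nil, Finset.sdiff_empty] at h0
    refine ⟨h0, Finset.union_comm _ _, fun i hi => ?_⟩
    have := h (i + 1) (by simpa using hi)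
    rwa [hs] at this
  · rintro ⟨h0, -, h⟩
    refine ⟨Finset.union_comm _ _, fun i hi => ?_⟩
    cases i with
    | zero => rw [List.take_zero, List.toFinset_nil, Finset.sdiff_empty]; exact h0
    | succ i =>
      rw [hs]
      exact h i (by simpa using hi)

theorem IsChain.isPerfectElim (ho : IsOrder G k Finset.univ C r) {v : V} {l : List V}
    (h : IsChain G C r v l) : IsPerfectElim G k (C ∪ (v :: l).toFinset) C (v :: l) := by
  induction h with
  | root v hv h =>
    have hc := IsChain.root v hv h
    rw [IsPerfectElim.cons_iff hc.notMem_tail]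
    exact ⟨hc.isKLeaf ho, by simp, by simp⟩
  | step v w l hv hp hl ih =>
    have hc := IsChain.step v w l hv hp hl
    rw [IsPerfectElim.cons_iff hc.notMem_tail]
    exact ⟨hc.isKLeaf ho, ih⟩

theorem isASeq_iff_reverse {v : V} {l : List V} : IsASeq G k C v l.reverse ↔
    v ∉ C ∧ (∀ w ∈ l, w ∉ C) ∧ IsPathType G k (C ∪ (v :: l).toFinset) ∧
      IsSimplicialClique G k (C ∪ (v :: l).toFinset) C ∧
      IsKLeaf G k (C ∪ (v :: l).toFinset) v ∧
      IsPerfectElim G k (C ∪ (v :: l).toFinset) C (v :: l) := by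
  have : (l.reverse ++ [v]).toFinset = (v :: l).toFinset := by
    ext x; simp
  rw [IsASeq, this, List.reverse_reverse]
  simp

theorem IsChain.isASeq (hk : 1 ≤ k) (ho : IsOrder G k Finset.univ C r) {v : V} {l : List V}
    (h : IsChain G C r v l) : IsASeq G k C v l.reverse :=
  isASeq_iff_reverse.2 ⟨h.notMem v (by simp), fun w hw => h.notMem w (by simp [hw]),
    h.isPathType ho, h.isSimplicialClique hk ho, h.isKLeaf ho, h.isPerfectElim ho⟩

/-- In a perfect elimination ordering, the later neighbours of `v` are those of smaller rank. -/
theorem IsOrder.nbrs_eq_lower (ho : IsOrder G k Finset.univ C r) {v : V} {S : Finset V}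
    (hv : v ∉ C) (hS : ∀ x ∈ S, x ∉ C → lower G Finset.univ r x ⊆ S) (hvS : v ∉ S)
    (hN : G.IsNClique k (nbrs G S v)) : nbrs G S v = lower G Finset.univ r v := by
  have hvN : v ∉ nbrs G S v := fun e => hvS (mem_nbrs.1 e).1
  have hQ : G.IsNClique (k + 1) (insert v (nbrs G S v)) := hN.insert fun b hb => (mem_nbrs.1 hb).2
  -- By counting, the top vertex `z` of this `(k + 1)`-clique has the rest as its lower set. If `z`
  -- were not `v`, closedness of `S` would force `v ∈ S`.
  obtain ⟨z, hz, hmax⟩ := Finset.exists_max_image _ r ⟨v, Finset.mem_insert_self v (nbrs G S v)⟩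
  have hzC : z ∉ C := by
    rw [← ho.zero z (Finset.mem_univ _)]
    have h1 := hmax v (Finset.mem_insert_self _ _)
    have h2 := (ho.zero v (Finset.mem_univ _)).not.2 hv
    omega
  have hsub : (insert v (nbrs G S v)).erase z ⊆ lower G Finset.univ r z := by
    intro x hx
    rw [Finset.mem_erase] at hx
    refine mem_lower.2 ⟨Finset.mem_univ _, hQ.isClique hz hx.2 hx.1.symm, ?_⟩
    refine (hmax x hx.2).lt_of_ne fun e => hx.1 ?_
    exact (ho.inj z (Finset.mem_univ _) x (Finset.mem_univ _) e.symm hzC).symm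
  rcases Finset.mem_insert.1 hz with rfl | hzN
  · rw [Finset.erase_insert hvN] at hsub
    exact Finset.eq_of_subset_of_card_le hsub
      (by rw [hN.card_eq, (ho.clique z (Finset.mem_univ _) hzC).card_eq])
  · have hzv : v ≠ z := fun e => hvN (e ▸ hzN)
    exact (hvS (hS z (mem_nbrs.1 hzN).1 hzC
      (hsub (Finset.mem_erase.2 ⟨hzv, Finset.mem_insert_self _ _⟩)))).elim

theorem IsPerfectElim.nodup {l : List V} (h : IsPerfectElim G k (C ∪ l.toFinset) C l) : l.Nodup := by
  rw [List.nodup_iff_injective_get]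
  intro i j hij
  by_contra hne
  wlog hlt : i < j generalizing i j
  · exact this hij.symm (Ne.symm hne) (lt_of_le_of_ne (not_lt.1 hlt) (Ne.symm hne))
  have h1 := (h.2 j j.2).2.2.1
  rw [Finset.mem_sdiff] at h1
  apply h1.2
  rw [List.mem_toFinset, List.mem_take_iff_getElem]
  exact ⟨i, by simp; omega, hij⟩

/-- The sets left in a perfect elimination ordering down to `C` are closed under `lower`. -/
theorem IsPerfectElim.lower_subset (ho : IsOrder G k Finset.univ C r) {l : List V}
    (hl : ∀ x ∈ l, x ∉ C) (h : IsPerfectElim G k (C ∪ l.toFinset) C l) :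
    ∀ x ∈ l, lower G Finset.univ r x ⊆ C ∪ l.toFinset := by
  have hnd := h.nodup
  induction l with
  | nil => simp
  | cons v l ih =>
    rw [List.nodup_cons] at hnd
    have hv : v ∉ C ∪ l.toFinset := by
      rw [Finset.mem_union, List.mem_toFinset, not_or]
      exact ⟨hl v (by simp), hnd.1⟩
    rw [IsPerfectElim.cons_iff hv] at h
    have hrec := ih (fun x hx => hl x (by simp [hx])) h.2 hnd.2
    have hsub : C ∪ l.toFinset ⊆ C ∪ (v :: l).toFinset := by
      rw [union_cons_toFinset]; exact Finset.subset_insert _ _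
    intro x hx
    rcases List.mem_cons.1 hx with rfl | hx
    · have hleaf := isKLeaf_iff.1 h.1
      have hn : nbrs G (C ∪ (x :: l).toFinset) x = nbrs G (C ∪ l.toFinset) x := by
        rw [union_cons_toFinset, nbrs_insert_of_not_adj (G.loopless.irrefl x)]
      rw [hn] at hleaf
      have hspec := hleaf.1.nbrs_spec hleaf.2.1 x hleaf.2.2.1
      rw [hn] at hspec
      rw [← ho.nbrs_eq_lower (hl x (by simp)) ?_ hv ⟨hspec.2 hleaf.2.2.2, hleaf.2.2.2⟩]
      · exact fun y hy => hsub (mem_nbrs.1 hy).1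
      · intro y hy hyC
        rcases Finset.mem_union.1 hy with hy | hy
        · exact (hyC hy).elim
        · exact hrec y (List.mem_toFinset.1 hy)
    · exact (hrec x hx).trans hsub

/-- The hypothesis `hch` excludes superfluous entries. Lower sets of later entries stay among later
entries and `C`, so the entry right after `v` can only be used by `v`; it is then the parent of `v`.
-/
theorem isChain_of_isPerfectElim (ho : IsOrder G k Finset.univ C r) {v : V} {l : List V}
    (hC : ∀ x ∈ v :: l, x ∉ C) (h : IsPerfectElim G k (C ∪ (v :: l).toFinset) C (v :: l))
    (hch : ∀ y ∈ l, ∃ x ∈ v :: l, y ∈ lower G Finset.univ r x) : IsChain G C r v l := by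
  have irr : ∀ x, x ∉ lower G Finset.univ r x := fun x e => (mem_lower.1 e).2.2.ne rfl
  induction l generalizing v with
  | nil =>
    have hsub := h.lower_subset ho hC v (by simp)
    refine .root v (hC v (by simp)) (Finset.eq_of_subset_of_card_le ?_ ?_)
    · intro x hx
      have := hsub hx
      simp only [List.toFinset_cons, List.toFinset_nil, Finset.mem_union, Finset.mem_insert,
        Finset.notMem_empty, or_false] at this
      rcases this with h | rfl
      · exact h
      · exact (irr _ hx).elim
    · rw [(ho.clique v (Finset.mem_univ _) (hC v (by simp))).card_eq, ho.root.card_eq]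
  | cons w l ih =>
    have hvC := hC v (by simp)
    have hwC := hC w (by simp)
    have hnd := h.nodup
    have htail : ∀ x, x ∉ C → x ∉ l → x ∉ C ∪ l.toFinset := by
      intro x h1 h2
      rw [Finset.mem_union, List.mem_toFinset, not_or]
      exact ⟨h1, h2⟩
    simp only [List.nodup_cons, List.mem_cons, not_or] at hnd
    have hw := htail w hwC hnd.2.1
    have hv : v ∉ C ∪ (w :: l).toFinset := by
      rw [Finset.mem_union, List.mem_toFinset, List.mem_cons]
      tauto
    have h1 := ((IsPerfectElim.cons_iff hv).1 h).2
    have h2 := ((IsPerfectElim.cons_iff hw).1 h1).2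
    have hsub2 := h2.lower_subset ho (fun x hx => hC x (by simp [hx]))
    have hwv : w ∈ lower G Finset.univ r v := by
      obtain ⟨x, hx, hwx⟩ := hch w (by simp)
      simp only [List.mem_cons] at hx
      rcases hx with rfl | rfl | hx
      · exact hwx
      · exact (irr _ hwx).elim
      · exact (hw (hsub2 x hx hwx)).elim
    -- A lower neighbour `u` of `v` ranked above `w` would have `w` in its own lower set. But `u`
    -- lies in `C` or in the tail `l`, and neither allows this.
    have hp : IsParent G C r v w := by
      refine ⟨hwC, hwv, fun u hu huw => ?_⟩
      by_contra hlt
      have hne : r w ≠ r u := fun e =>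
        huw (ho.inj w (Finset.mem_univ _) u (Finset.mem_univ _) e hwC).symm
      have hwu : w ∈ lower G Finset.univ r u := mem_lower.2 ⟨Finset.mem_univ _,
        (ho.clique v (Finset.mem_univ _) hvC).isClique hu hwv huw, by omega⟩
      have hum := h.lower_subset ho hC v (by simp) hu
      simp only [Finset.mem_union, List.mem_toFinset, List.mem_cons] at hum
      rcases hum with hum | rfl | rfl | hum
      · have h0 := (ho.zero u (Finset.mem_univ _)).2 hum
        have := (mem_lower.1 hwu).2.2
        omega
      · exact irr _ hu
      · exact huw rfl
      · exact hw (hsub2 u hum hwu)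
    refine .step v w l hvC hp (ih (fun x hx => hC x (by simp [List.mem_cons.1 hx])) h1 ?_)
    intro y hy
    obtain ⟨x, hx, hyx⟩ := hch y (by simp [hy])
    rcases List.mem_cons.1 hx with rfl | hx
    · refine ⟨w, by simp, ho.lower_subset hvC hp hyx ?_⟩
      rintro rfl
      exact hnd.2.1 hy
    · exact ⟨x, hx, hyx⟩

/-- Being path-type leaves room for only two `k`-leaves, and these are `v` and some `c ∈ C`. Every
other entry `y` thus has degree above `k`, so it has a neighbour ranked above it, which supplies the
hypothesis `hch` of `isChain_of_isPerfectElim`. -/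
theorem isChain_of_isASeq (ho : IsOrder G k Finset.univ C r) {v : V} {l : List V}
    (h : IsASeq G k C v l.reverse) : IsChain G C r v l := by
  rw [isASeq_iff_reverse] at h
  obtain ⟨hvC, hlC, hpath, hsimp, hleaf, hel⟩ := h
  have hC : ∀ x ∈ v :: l, x ∉ C := by simpa using ⟨hvC, hlC⟩
  have hnd := hel.nodup
  have hsub := hel.lower_subset ho hC
  refine isChain_of_isPerfectElim ho hC hel fun y hy => ?_
  have hyC := hlC y hy
  have hyl : y ∈ v :: l := by simp [hy]
  obtain ⟨-, -, c, hcC, hc⟩ := hsimp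
  have hvy : v ≠ y := fun e => (List.nodup_cons.1 hnd).1 (e ▸ hy)
  have hcv : c ≠ v := fun e => hvC (e ▸ hcC)
  have hcy : c ≠ y := fun e => hyC (e ▸ hcC)
  have hcard : k + 2 ≤ (C ∪ (v :: l).toFinset).card := by
    have h1 : insert v (insert y C) ⊆ C ∪ (v :: l).toFinset := by
      intro x hx
      simp only [Finset.mem_insert, Finset.mem_union, List.mem_toFinset, List.mem_cons] at hx ⊢
      rcases hx with rfl | rfl | hx <;> simp [*]
    have h2 := Finset.card_le_card h1
    rw [Finset.card_insert_of_notMem (by simp [hvy, hvC]), Finset.card_insert_of_notMem hyC,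
      ho.root.card_eq] at h2
    exact h2
  obtain ⟨L, hL, hL'⟩ := hpath.exists_leaves hcard
  have hny : ¬ IsKLeaf G k (C ∪ (v :: l).toFinset) y := by
    intro hyleaf
    have h1 : ({c, v, y} : Finset V) ⊆ L := by
      intro x hx
      simp only [Finset.mem_insert, Finset.mem_singleton] at hx
      rcases hx with rfl | rfl | rfl
      · exact hL' _ hc
      · exact hL' _ hleaf
      · exact hL' _ hyleaf
    have h2 := Finset.card_le_card h1
    rw [Finset.card_eq_three.2 ⟨c, v, y, hcv, hcy, hvy, rfl⟩] at h2
    omega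
  have hcl := (ho.clique y (Finset.mem_univ _) hyC).card_eq
  have hyS : y ∈ C ∪ (v :: l).toFinset := by simp [hy]
  rw [isKLeaf_iff] at hny
  obtain ⟨x, hx, hxl⟩ : ∃ x ∈ nbrs G (C ∪ (v :: l).toFinset) y,
      x ∉ lower G Finset.univ r y := by
    by_contra! hle
    have h1 := (hleaf.1.nbrs_spec hleaf.2.1 y hyS).1
    have h2 := Finset.card_le_card hle
    exact hny ⟨hleaf.1, hleaf.2.1, hyS, by omega⟩
  rw [mem_nbrs] at hx
  have hlt : r y < r x := by
    have h1 : ¬ r x < r y := fun e => hxl (mem_lower.2 ⟨Finset.mem_univ _, hx.2, e⟩)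
    have h2 : r y ≠ r x := fun e =>
      hx.2.ne (ho.inj y (Finset.mem_univ _) x (Finset.mem_univ _) e hyC)
    omega
  refine ⟨x, ?_, mem_lower.2 ⟨Finset.mem_univ _, hx.2.symm, hlt⟩⟩
  rcases Finset.mem_union.1 hx.1 with h | h
  · have := (ho.zero x (Finset.mem_univ _)).2 h; omega
  · exact List.mem_toFinset.1 h

end Chain

/-! ### The characteristic tree as a parent relation. -/

section CharTree

variable {V : Type*} [DecidableEq V] [Fintype V] {G : SimpleGraph V} {k : ℕ} {C : Finset V}
  {r : V → ℕ}

/-- `Par a b`: in the characteristic tree rooted at `C`, the vertex `b` is the parent of `a`. -/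
inductive Par (G : SimpleGraph V) (C : Finset V) (r : V → ℕ) : Finset V ⊕ V → Finset V ⊕ V → Prop
  | root (v : V) (hv : v ∉ C) (h : lower G Finset.univ r v = C) :
      Par G C r (Sum.inr v) (Sum.inl C)
  | step (v w : V) (hv : v ∉ C) (h : IsParent G C r v w) : Par G C r (Sum.inr v) (Sum.inr w)

theorem IsParent.eq {v w x : V} (h : IsParent G C r v w) (h' : IsParent G C r v x) : x = w := by
  by_contra hne
  have h1 := h.2.2 x h'.2.1 hne
  have h2 := h'.2.2 w h.2.1 (Ne.symm hne)
  omega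

theorem par_iff_of_root {v : V} (hv : v ∉ C) (h : lower G Finset.univ r v = C)
    {b : Finset V ⊕ V} : Par G C r (Sum.inr v) b ↔ b = Sum.inl C := by
  constructor
  · rintro (⟨-, -, -⟩ | ⟨_, w, -, hp⟩)
    · rfl
    · exact (hp.1 (h ▸ hp.2.1)).elim
  · rintro rfl
    exact .root v hv h

theorem par_iff_of_parent {v w : V} (hv : v ∉ C) (h : IsParent G C r v w)
    {b : Finset V ⊕ V} : Par G C r (Sum.inr v) b ↔ b = Sum.inr w := by
  constructor
  · intro hb
    cases hb with
    | root _ _ h0 => exact (h.1 (h0 ▸ h.2.1)).elim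
    | step _ x _ hp => rw [h.eq hp]
  · rintro rfl
    exact .step v w hv h

theorem IsChain.infix_iff {v : V} {l : List V} (h : IsChain G C r v l) {a b : Finset V ⊕ V} :
    [a, b] <:+: (v :: l).map Sum.inr ++ [Sum.inl C] ↔
      ∃ x ∈ v :: l, a = Sum.inr x ∧ Par G C r (Sum.inr x) b := by
  induction h with
  | root v hv h => simp [List.infix_cons_iff, List.cons_prefix_cons, par_iff_of_root hv h]
  | step v w l hv hp hl ih =>
    rw [List.map_cons, List.cons_append, List.infix_cons_iff, ih]
    simp only [List.map_cons, List.cons_append, List.cons_prefix_cons, List.nil_prefix, and_true,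
      List.mem_cons, exists_eq_or_imp, par_iff_of_parent hv hp]

/-- Every vertex outside `C` lies on the chain of a `k`-leaf. -/
theorem IsOrder.exists_leaf (ho : IsOrder G k Finset.univ C r) (hT : IsKTree G k) {w : V}
    (hw : w ∉ C) : ∃ v l, IsKLeaf G k Finset.univ v ∧ IsChain G C r v l ∧ w ∈ v :: l := by
  classical
  obtain ⟨l₀, hl₀⟩ := ho.exists_chain _ w (Nat.lt_succ_self _) hw
  let A : Finset V := Finset.univ.filter fun v => ∃ l, IsChain G C r v l ∧ w ∈ v :: l
  -- A highest-ranked descendant of `w` is a leaf of `T`: any neighbour above it would give it a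
  -- child.
  obtain ⟨v, hvA, hmax⟩ := Finset.exists_max_image A r 
    ⟨w, Finset.mem_filter.2 ⟨Finset.mem_univ _, l₀, hl₀, by simp⟩⟩
  obtain ⟨l, hl, hwl⟩ := (Finset.mem_filter.1 hvA).2
  have hvC := hl.notMem v (by simp)
  have hcard : k + 1 ≤ (Finset.univ : Finset V).card := by
    rw [← ho.root.card_eq, ← Finset.card_insert_of_notMem hw]
    exact Finset.card_le_card (Finset.subset_univ _)
  refine ⟨v, l, ?_, hl, hwl⟩
  rw [isKLeaf_iff]
  refine ⟨hT, hcard, Finset.mem_univ _, ?_⟩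
  suffices hs : nbrs G Finset.univ v = lower G Finset.univ r v by
    rw [hs]; exact (ho.clique v (Finset.mem_univ _) hvC).card_eq
  ext x
  rw [mem_nbrs, mem_lower]
  refine ⟨fun hx => ⟨hx.1, hx.2, ?_⟩, fun hx => ⟨hx.1, hx.2.1⟩⟩
  by_contra hlt
  have hne : r v ≠ r x := fun e =>
    hx.2.ne (ho.inj v (Finset.mem_univ _) x (Finset.mem_univ _) e hvC)
  let B : Finset V := Finset.univ.filter fun y => v ∈ lower G Finset.univ r y
  -- The earliest `y` that uses `v` is a child of `v`: if its parent were another vertex, that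
  -- parent would use `v` even earlier.
  obtain ⟨y, hy, hmin⟩ := Finset.exists_min_image B r
    ⟨x, by simp only [B, Finset.mem_filter, mem_lower]
           exact ⟨Finset.mem_univ _, Finset.mem_univ _, hx.2.symm, by omega⟩⟩
  have hvy := (Finset.mem_filter.1 hy).2
  have hyC : y ∉ C := by
    rw [← ho.zero y (Finset.mem_univ _)]
    have := (mem_lower.1 hvy).2.2
    omega
  have hp : IsParent G C r y v := by
    rcases ho.root_or_parent hyC with h0 | ⟨u, hu⟩
    · exact (hvC (h0 ▸ hvy)).elim
    · by_cases hvu : v = u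
      · rwa [hvu]
      · have := hmin u (Finset.mem_filter.2 ⟨Finset.mem_univ _, ho.lower_subset hyC hu hvy hvu⟩)
        have := hu.lt
        omega
  have := hmax y (Finset.mem_filter.2 ⟨Finset.mem_univ _, v :: l, .step y v l hyC hp hl,
    List.mem_cons_of_mem _ hwl⟩)
  have := hp.lt
  omega

theorem charTree_path_eq (v : V) (l : List V) :
    (Sum.inl C :: (l.reverse ++ [v]).map Sum.inr : List (Finset V ⊕ V)) =
      ((v :: l).map Sum.inr ++ [Sum.inl C]).reverse := by
  simp

theorem charTree_adj (hk : 1 ≤ k) (ho : IsOrder G k Finset.univ C r) (hT : IsKTree G k)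
    {a b : Finset V ⊕ V} :
    (charTree G k C).Adj a b ↔ Par G C r a b ∨ Par G C r b a := by
  have hinf : ∀ {v l} {a b : Finset V ⊕ V}, IsChain G C r v l →
      ([a, b] <:+: (Sum.inl C :: (l.reverse ++ [v]).map Sum.inr : List (Finset V ⊕ V)) ↔
        ∃ x ∈ v :: l, b = Sum.inr x ∧ Par G C r (Sum.inr x) a) := by
    intro v l a b hc
    rw [← hc.infix_iff, charTree_path_eq, ← List.reverse_infix, List.reverse_reverse]
    rfl
  have hne : ∀ {a b : Finset V ⊕ V}, Par G C r a b → a ≠ b := by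
    rintro a b (⟨v, -, -⟩ | ⟨v, w, -, hp⟩)
    · simp
    · have := hp.lt
      rintro h
      rw [Sum.inr.inj h] at this
      omega
  simp only [charTree, SimpleGraph.Subgraph.iSup_adj, listPath]
  constructor
  · rintro ⟨v, -, ws, hws, -, hi⟩
    obtain ⟨l, rfl⟩ : ∃ l, ws = List.reverse l := ⟨ws.reverse, by simp⟩
    have hc := isChain_of_isASeq ho hws
    rw [hinf hc, hinf hc] at hi
    rcases hi with ⟨x, -, rfl, h⟩ | ⟨x, -, rfl, h⟩
    · exact Or.inr h
    · exact Or.inl h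
  · have key : ∀ {a b : Finset V ⊕ V}, Par G C r a b → ∃ v,
        ∃ (_ : IsKLeaf G k Finset.univ v ∧ v ∉ C), ∃ ws, ∃ (_ : IsASeq G k C v ws),
          [b, a] <:+: (Sum.inl C :: (ws ++ [v]).map Sum.inr : List (Finset V ⊕ V)) := by
      intro a b h
      obtain ⟨w, hw, rfl⟩ : ∃ w, w ∉ C ∧ a = Sum.inr w := by
        cases h with
        | root w hw _ => exact ⟨w, hw, rfl⟩
        | step w _ hw _ => exact ⟨w, hw, rfl⟩
      obtain ⟨v, l, hv, hl, hwl⟩ := ho.exists_leaf hT hw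
      exact ⟨v, ⟨hv, hl.notMem v (by simp)⟩, l.reverse, hl.isASeq hk ho,
        (hinf hl).2 ⟨w, hwl, rfl, h⟩⟩
    rintro (h | h)
    · obtain ⟨v, hv, ws, hws, hi⟩ := key h
      exact ⟨v, hv, ws, hws, hne h, Or.inr hi⟩
    · obtain ⟨v, hv, ws, hws, hi⟩ := key h
      exact ⟨v, hv, ws, hws, (hne h).symm, Or.inl hi⟩

/-- The vertex `c` outside `C` is needed for the root: without one the union of paths is empty and
`C` is not in it. -/
theorem mem_charTree_verts (hk : 1 ≤ k) (ho : IsOrder G k Finset.univ C r) (hT : IsKTree G k)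
    {c : V} (hc : c ∉ C) {a : Finset V ⊕ V} :
    a ∈ (charTree G k C).verts ↔ a = Sum.inl C ∨ ∃ v ∉ C, a = Sum.inr v := by
  simp only [charTree, SimpleGraph.Subgraph.verts_iSup, listPath, Set.mem_iUnion, Set.mem_ofPred_eq]
  constructor
  · rintro ⟨v, ⟨-, hv⟩, ws, hws, ha⟩
    simp only [List.mem_cons, List.mem_map, List.mem_append, List.not_mem_nil, or_false] at ha
    rcases ha with rfl | ⟨x, hx | rfl, rfl⟩
    · exact Or.inl rfl
    · exact Or.inr ⟨x, hws.2.1 x hx, rfl⟩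
    · exact Or.inr ⟨x, hv, rfl⟩
  · have key : ∀ w, w ∉ C → ∃ v, ∃ (_ : IsKLeaf G k Finset.univ v ∧ v ∉ C), ∃ ws,
        ∃ (_ : IsASeq G k C v ws), w ∈ ws ++ [v] := by
      intro w hw
      obtain ⟨v, l, hv, hl, hwl⟩ := ho.exists_leaf hT hw
      exact ⟨v, ⟨hv, hl.notMem v (by simp)⟩, l.reverse, hl.isASeq hk ho, by
        simpa [or_comm] using hwl⟩
    rintro (rfl | ⟨w, hw, rfl⟩)
    · obtain ⟨v, hv, ws, hws, -⟩ := key c hc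
      exact ⟨v, hv, ws, hws, by simp⟩
    · obtain ⟨v, hv, ws, hws, hm⟩ := key w hw
      exact ⟨v, hv, ws, hws, List.mem_cons_of_mem _ (List.mem_map_of_mem hm)⟩

end CharTree

/-! ### Characteristic trees are trees. -/

/-- A graph given by a parent relation which decreases a rank is a tree. -/
theorem isTree_of_parent {X : Type*} {G : SimpleGraph X} (P : X → X → Prop) (ρ : X → ℕ) (x₀ : X)
    (hadj : ∀ a b, G.Adj a b ↔ P a b ∨ P b a) (hlt : ∀ a b, P a b → ρ b < ρ a)
    (huniq : ∀ a b c, P a b → P a c → b = c) (hex : ∀ a, a ≠ x₀ → ∃ b, P a b) : G.IsTree := by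
  have hreach : ∀ (n : ℕ) (a : X), ρ a < n → G.Reachable a x₀ := by
    intro n
    induction n with
    | zero => intro a h; omega
    | succ n ih =>
      intro a ha
      by_cases hax : a = x₀
      · rw [hax]
      · obtain ⟨b, hb⟩ := hex a hax
        have := hlt a b hb
        exact ((hadj a b).2 (Or.inl hb)).reachable.trans (ih b (by omega))
  have hr : ∀ a, G.Reachable a x₀ := fun a => hreach _ a (Nat.lt_succ_self _)
  refine ⟨(SimpleGraph.connected_iff G).2 ⟨fun a b => (hr a).trans (hr b).symm, ⟨x₀⟩⟩, ?_⟩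
  intro v p hp
  classical
  -- Both cycle neighbours of a highest-ranked vertex of a cycle are its parent, so they coincide,
  -- which no cycle allows.
  obtain ⟨m, hm, hmax⟩ := p.support.toFinset.exists_max_image ρ ⟨v, by simp⟩
  rw [List.mem_toFinset] at hm
  have hq := hp.rotate hm
  have hpar : ∀ x ∈ (p.rotate m hm).support, G.Adj m x → P m x := by
    intro x hx hmx
    rcases (hadj m x).1 hmx with h | h
    · exact h
    · have h1 := hlt _ _ h
      have h2 := hmax x (List.mem_toFinset.2 (by simpa using hx))
      omega
  have hnil := hq.not_nil
  exact hq.snd_ne_penultimate (huniq m _ _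
    (hpar _ (SimpleGraph.Walk.getVert_mem_support _ _) (SimpleGraph.Walk.adj_snd hnil))
    (hpar _ (SimpleGraph.Walk.getVert_mem_support _ _)
      (SimpleGraph.Walk.adj_penultimate hnil).symm))

section Kelmans

variable {V : Type*} [DecidableEq V] [Fintype V] {G : SimpleGraph V} {k : ℕ} {C : Finset V}
  {r : V → ℕ}

theorem charTree_isTree (hk : 1 ≤ k) (ho : IsOrder G k Finset.univ C r) (hT : IsKTree G k)
    {c : V} (hc : c ∉ C) : (charTree G k C).coe.IsTree := by
  have hv := fun a => mem_charTree_verts hk ho hT hc (a := a)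
  refine isTree_of_parent (fun a b => Par G C r a.1 b.1) (fun a => Sum.elim (fun _ => 0) r a.1)
    ⟨Sum.inl C, (hv _).2 (Or.inl rfl)⟩ ?_ ?_ ?_ ?_
  · intro a b
    exact charTree_adj hk ho hT
  · rintro ⟨a, ha⟩ ⟨b, hb⟩ (⟨v, hv, -⟩ | ⟨v, w, -, hp⟩)
    · exact Nat.pos_of_ne_zero ((ho.zero v (Finset.mem_univ _)).not.2 hv)
    · exact hp.lt
  · rintro ⟨a, ha⟩ ⟨b, hb⟩ ⟨c, hc⟩ h1 h2
    apply Subtype.ext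
    change b = c
    change Par G C r a b at h1
    change Par G C r a c at h2
    cases h1 with
    | root v hv h => exact ((par_iff_of_root hv h).1 h2).symm
    | step v w hv h => exact ((par_iff_of_parent hv h).1 h2).symm
  · rintro ⟨a, ha⟩ hne
    rcases (hv a).1 ha with rfl | ⟨v, hvC, rfl⟩
    · exact (hne rfl).elim
    · rcases ho.root_or_parent hvC with h | ⟨w, hw⟩
      · exact ⟨⟨Sum.inl C, (hv _).2 (Or.inl rfl)⟩, .root v hvC h⟩
      · exact ⟨⟨Sum.inr w, (hv _).2 (Or.inr ⟨w, hw.1, rfl⟩)⟩, .step v w hvC hw⟩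

/-- The parent is the first vertex `c` when all lower neighbours are in `insert c C`. -/
theorem IsOrder.isParent_first (ho : IsOrder G k Finset.univ C r) {c v : V} (hrc : r c = 1)
    (hv : v ∉ C) (hsub : lower G Finset.univ r v ⊆ insert c C)
    (hne : lower G Finset.univ r v ≠ C) : IsParent G C r v c := by
  have hc : c ∉ C := fun e => by have := (ho.zero c (Finset.mem_univ _)).2 e; omega
  refine ⟨hc, ?_, fun u hu huc => ?_⟩
  · by_contra hcl
    apply hne
    apply Finset.eq_of_subset_of_card_le
    · intro x hx
      exact Finset.mem_of_mem_insert_of_ne (hsub hx) (fun e : x = c => hcl (e ▸ hx))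
    · rw [(ho.clique v (Finset.mem_univ _) hv).card_eq, ho.root.card_eq]
  · rw [(ho.zero u (Finset.mem_univ _)).2 (Finset.mem_of_mem_insert_of_ne (hsub hu) huc), hrc]
    exact Nat.one_pos

end Kelmans

/-! ### Comparing the parents for two adjacent cliques. -/

section Exchange

variable {V : Type*} [DecidableEq V] [Fintype V] {G : SimpleGraph V} {k : ℕ} {C : Finset V}
  {r : V → ℕ} {c d : V}

/-- The vertices whose parent changes from `c` to `C` when `d ∈ C` is exchanged for `c`. -/
def moved (G : SimpleGraph V) (C : Finset V) (r : V → ℕ) (c d : V) : Set (Finset V ⊕ V) :=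
  {x | ∃ v, x = Sum.inr v ∧ v ∉ insert c C ∧ lower G Finset.univ r v ⊆ insert c C ∧
    lower G Finset.univ r v ≠ C ∧ lower G Finset.univ r v ≠ insert c (C.erase d)}

/-- The bijection between the vertices of the two characteristic trees. -/
def exchange (C : Finset V) (c d : V) : Equiv.Perm (Finset V ⊕ V) :=
  (Equiv.swap (Sum.inl (insert c (C.erase d))) (Sum.inr c)).trans
    (Equiv.swap (Sum.inr d) (Sum.inl C))

theorem exchange_root (hc : c ∉ C) (hd : d ∈ C) :
    exchange C c d (Sum.inl (insert c (C.erase d))) = Sum.inr c := by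
  have hcd : c ≠ d := fun e => hc (e ▸ hd)
  rw [exchange, Equiv.trans_apply, Equiv.swap_apply_left, Equiv.swap_apply_of_ne_of_ne]
  · simpa using hcd
  · simp

theorem exchange_first (hc : c ∉ C) (hd : d ∈ C) :
    exchange C c d (Sum.inr d) = Sum.inl C := by
  have hcd : c ≠ d := fun e => hc (e ▸ hd)
  have h := Equiv.swap_apply_of_ne_of_ne (a := Sum.inl (insert c (C.erase d))) (b := Sum.inr c)
    (x := Sum.inr d) (by simp) (by simpa using hcd.symm)
  rw [exchange, Equiv.trans_apply, h, Equiv.swap_apply_left]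

theorem exchange_of_ne {v : V} (hvc : v ≠ c) (hvd : v ≠ d) :
    exchange C c d (Sum.inr v) = Sum.inr v := by
  have h := Equiv.swap_apply_of_ne_of_ne (a := Sum.inl (insert c (C.erase d))) (b := Sum.inr c)
    (x := Sum.inr v) (by simp) (by simpa using hvc)
  rw [exchange, Equiv.trans_apply, h]
  exact Equiv.swap_apply_of_ne_of_ne (by simpa using hvd) (by simp)

theorem notMem_insert_erase {v : V} (hv : v ∉ insert c C) :
    v ∉ insert c (C.erase d) := fun e => hv <| by
  rw [Finset.mem_insert, Finset.mem_erase] at e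
  rw [Finset.mem_insert]
  tauto

theorem insert_exchange (hd : d ∈ C) : insert d (insert c (C.erase d)) = insert c C := by
  rw [Finset.insert_comm, Finset.insert_erase hd]

theorem IsOrder.parent_exchange (ho : IsOrder G k Finset.univ C r) (hrc : r c = 1)
    (hadj : ∀ w ∈ C, G.Adj c w) (hd : d ∈ C) {v : V} (hv : v ∉ insert c C) :
    ∃ y, (∀ b, Par G (insert c (C.erase d)) (r ∘ Equiv.swap c d) (Sum.inr v) b ↔ b = y) ∧
      ((Sum.inr v ∉ moved G C r c d ∧
          ∀ b, Par G C r (Sum.inr v) b ↔ b = exchange C c d y) ∨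
        (Sum.inr v ∈ moved G C r c d ∧ (∀ b, Par G C r (Sum.inr v) b ↔ b = Sum.inr c) ∧
          exchange C c d y = Sum.inl C)) := by
  have hmem : ∀ x : V, x ∈ Finset.univ := Finset.mem_univ
  have ho' := ho.swap (hmem c) hrc hadj hd
  have hc : c ∉ C := fun e => by have := (ho.zero c (hmem c)).2 e; omega
  have hcd : c ≠ d := fun e => hc (e ▸ hd)
  have h0 := (ho.zero d (hmem d)).2 hd
  have hvC' := notMem_insert_erase (d := d) hv
  have hv' := hv
  rw [Finset.mem_insert, not_or] at hv'
  obtain ⟨hvc, hvC⟩ := hv'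
  have hlow := ho.lower_swap (hmem c) hrc hd (hmem v) hvC hvc
  have hrd : (r ∘ Equiv.swap c d) d = 1 := by simp [hrc]
  have hmv : Sum.inr v ∈ moved G C r c d ↔ lower G Finset.univ r v ⊆ insert c C ∧
      lower G Finset.univ r v ≠ C ∧ lower G Finset.univ r v ≠ insert c (C.erase d) := by
    constructor
    · rintro ⟨w, hw, h⟩
      obtain rfl := Sum.inr.inj hw
      exact h.2
    · exact fun h => ⟨v, rfl, hv, h⟩
  by_cases hsub : lower G Finset.univ r v ⊆ insert c C
  · by_cases h1 : lower G Finset.univ r v = insert c (C.erase d)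
    · refine ⟨_, fun b => par_iff_of_root hvC' (hlow.trans h1), Or.inl ⟨?_, fun b => ?_⟩⟩
      · rw [hmv]; tauto
      · rw [exchange_root hc hd]
        refine par_iff_of_parent hvC (ho.isParent_first hrc hvC hsub ?_)
        rw [h1]
        exact fun e => hc (e ▸ Finset.mem_insert_self _ _)
    · have hp := ho'.isParent_first hrd hvC' (by rwa [hlow, insert_exchange hd]) (by rwa [hlow])
      refine ⟨_, fun b => par_iff_of_parent hvC' hp, ?_⟩
      rw [exchange_first hc hd]
      by_cases h2 : lower G Finset.univ r v = C
      · exact Or.inl ⟨by rw [hmv]; tauto, fun b => par_iff_of_root hvC h2⟩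
      · exact Or.inr ⟨hmv.2 ⟨hsub, h2, h1⟩,
          fun b => par_iff_of_parent hvC (ho.isParent_first hrc hvC hsub h2), rfl⟩
  · obtain ⟨w, hw⟩ : ∃ w, IsParent G C r v w := by
      rcases ho.root_or_parent hvC with h | h
      · exact (hsub (h ▸ Finset.subset_insert _ _)).elim
      · exact h
    -- If the parent were `c`, of rank 1, all other lower neighbours would have rank 0 and lie in
    -- `C`.
    have hwQ : w ∉ insert c C := by
      intro e
      rcases Finset.mem_insert.1 e with rfl | e
      · apply hsub
        intro x hx
        by_cases hxw : x = w
        · simp [hxw]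
        · have := hw.2.2 x hx hxw
          exact Finset.mem_insert_of_mem ((ho.zero x (hmem x)).1 (by omega))
      · exact hw.1 e
    have hwC' := notMem_insert_erase (d := d) hwQ
    rw [Finset.mem_insert, not_or] at hwQ
    have hwd : w ≠ d := fun e => hwQ.2 (e ▸ hd)
    -- The swap only affects ranks 0 and 1, so a parent of rank above 1 remains the top element.
    have hw1 : 1 < r w := by
      have h1 := (ho.zero w (hmem w)).not.2 hw.1
      have h2 : r w ≠ r c := fun e => hwQ.1 (ho.inj w (hmem w) c (hmem c) e hw.1)
      omega
    have hw' : IsParent G (insert c (C.erase d)) (r ∘ Equiv.swap c d) v w := by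
      refine ⟨hwC', by rw [hlow]; exact hw.2.1, ?_⟩
      rw [hlow]
      intro u hu huw
      simp only [Function.comp, Equiv.swap_apply_of_ne_of_ne hwQ.1 hwd]
      by_cases huc : u = c
      · rw [huc, Equiv.swap_apply_left]; omega
      by_cases hud : u = d
      · rw [hud, Equiv.swap_apply_right]; omega
      rw [Equiv.swap_apply_of_ne_of_ne huc hud]
      exact hw.2.2 u hu huw
    refine ⟨_, fun b => par_iff_of_parent hvC' hw', Or.inl ⟨by rw [hmv]; tauto, fun b => ?_⟩⟩
    rw [exchange_of_ne hwQ.1 hwd]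
    exact par_iff_of_parent hvC hw

/-- The left side is adjacency after the Kelmans operation, written without subtypes. Edges are
compared through their child, using `IsOrder.parent_exchange`; only the edge between `c` and the
root is treated separately. -/
theorem IsOrder.adj_exchange (ho : IsOrder G k Finset.univ C r) (hrc : r c = 1)
    (hadj : ∀ w ∈ C, G.Adj c w) (hd : d ∈ C) (x y : Finset V ⊕ V) :
    ((Par G C r (exchange C c d x) (exchange C c d y) ∨
        Par G C r (exchange C c d y) (exchange C c d x)) ∧
        ¬ (∃ w ∈ moved G C r c d,
          s(exchange C c d x, exchange C c d y) = s(Sum.inr c, w)) ∨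
      ∃ w ∈ moved G C r c d, s(exchange C c d x, exchange C c d y) = s(Sum.inl C, w)) ↔
    Par G (insert c (C.erase d)) (r ∘ Equiv.swap c d) x y ∨
      Par G (insert c (C.erase d)) (r ∘ Equiv.swap c d) y x := by
  have hmem : ∀ x : V, x ∈ Finset.univ := Finset.mem_univ
  have ho' := ho.swap (hmem c) hrc hadj hd
  have hc : c ∉ C := fun e => by have := (ho.zero c (hmem c)).2 e; omega
  have hcd : c ≠ d := fun e => hc (e ▸ hd)
  have hdC' : d ∉ insert c (C.erase d) := by simp [hcd.symm]
  have hfirst : ∀ b, Par G C r (Sum.inr c) b ↔ b = Sum.inl C := fun b =>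
    par_iff_of_root hc (ho.lower_eq_root (hmem c) hc hadj)
  have hfirst' : ∀ b, Par G (insert c (C.erase d)) (r ∘ Equiv.swap c d) (Sum.inr d) b ↔
      b = Sum.inl (insert c (C.erase d)) := fun b => by
    refine par_iff_of_root hdC' (ho'.lower_eq_root (hmem d) hdC' fun w hw => ?_)
    rcases Finset.mem_insert.1 hw with rfl | hw
    · exact (hadj d hd).symm
    · exact ho.root.isClique hd (Finset.mem_of_mem_erase hw) (Finset.ne_of_mem_erase hw).symm
  have hinl : ∀ D, Sum.inl D ∉ moved G C r c d := by rintro D ⟨v, hv, -⟩; cases hv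
  have hcm : Sum.inr c ∉ moved G C r c d := by
    rintro ⟨v, hv, h, -⟩
    obtain rfl := Sum.inr.inj hv
    exact h (Finset.mem_insert_self _ _)
  have hfix : ∀ v, v ∉ insert c C → exchange C c d (Sum.inr v) = Sum.inr v := by
    intro v hv
    rw [Finset.mem_insert, not_or] at hv
    exact exchange_of_ne hv.1 fun e => hv.2 (e ▸ hd)
  have inj := (exchange C c d).injective
  have fwd : ∀ x y : Finset V ⊕ V, Par G C r (exchange C c d x) (exchange C c d y) →
      ¬ (∃ w ∈ moved G C r c d, s(exchange C c d x, exchange C c d y) = s(Sum.inr c, w)) →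
      Par G (insert c (C.erase d)) (r ∘ Equiv.swap c d) x y ∨
        Par G (insert c (C.erase d)) (r ∘ Equiv.swap c d) y x := by
    intro x y hp hn
    obtain ⟨v, hvC, hv⟩ : ∃ v ∉ C, exchange C c d x = Sum.inr v := by
      generalize exchange C c d x = a, exchange C c d y = b at hp
      cases hp with
      | root v hv _ => exact ⟨v, hv, rfl⟩
      | step v _ hv _ => exact ⟨v, hv, rfl⟩
    rw [hv] at hp hn
    by_cases hvc : v = c
    · subst hvc
      rw [hfirst, ← exchange_first hc hd] at hp
      rw [← exchange_root hc hd] at hv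
      rw [inj hp, inj hv]
      -- The edge from `c` up to `C` corresponds to the one between `d` and the new root, with child
      -- and parent interchanged.
      exact Or.inr ((hfirst' _).2 rfl)
    · have hvQ : v ∉ insert c C := by simp [hvc, hvC]
      rw [← hfix v hvQ] at hv
      obtain rfl := inj hv
      obtain ⟨z, hz, ⟨hm, h⟩ | ⟨hm, h, -⟩⟩ := ho.parent_exchange hrc hadj hd hvQ
      · exact Or.inl ((hz _).2 (inj ((h _).1 hp)))
      · exact (hn ⟨_, hm, by rw [(h _).1 hp]; exact Sym2.eq_swap⟩).elim
  have fwd2 : ∀ x y : Finset V ⊕ V, exchange C c d x = Sum.inl C →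
      exchange C c d y ∈ moved G C r c d →
      Par G (insert c (C.erase d)) (r ∘ Equiv.swap c d) y x := by
    intro x y hx hy
    obtain ⟨v, hv, hvQ, -⟩ := id hy
    rw [hv] at hy
    rw [← hfix v hvQ] at hv
    obtain rfl := inj hv
    obtain ⟨z, hz, ⟨hm, h⟩ | ⟨hm, h, hzC⟩⟩ := ho.parent_exchange hrc hadj hd hvQ
    · exact (hm hy).elim
    · exact (hz _).2 (inj (hx.trans hzC.symm))
  have bwd : ∀ x y : Finset V ⊕ V,
      Par G (insert c (C.erase d)) (r ∘ Equiv.swap c d) x y →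
      ((Par G C r (exchange C c d x) (exchange C c d y) ∨
        Par G C r (exchange C c d y) (exchange C c d x)) ∧
        ¬ (∃ w ∈ moved G C r c d,
          s(exchange C c d x, exchange C c d y) = s(Sum.inr c, w)) ∨
      ∃ w ∈ moved G C r c d, s(exchange C c d x, exchange C c d y) = s(Sum.inl C, w)) := by
    intro x y hp
    obtain ⟨v, hvC, rfl⟩ : ∃ v ∉ insert c (C.erase d), x = Sum.inr v := by
      cases hp with
      | root v hv _ => exact ⟨v, hv, rfl⟩
      | step v _ hv _ => exact ⟨v, hv, rfl⟩
    by_cases hvd : v = d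
    · subst hvd
      rw [(hfirst' _).1 hp, exchange_first hc hd, exchange_root hc hd]
      refine Or.inl ⟨Or.inr ((hfirst _).2 rfl), ?_⟩
      rintro ⟨w, hw, he⟩
      rw [Sym2.eq_swap, Sym2.congr_right] at he
      exact hinl _ (he ▸ hw)
    · have hvQ : v ∉ insert c C := by
        rw [← insert_exchange hd, Finset.mem_insert, not_or]
        exact ⟨hvd, hvC⟩
      rw [hfix v hvQ]
      obtain ⟨z, hz, ⟨hm, h⟩ | ⟨hm, h, hzC⟩⟩ := ho.parent_exchange hrc hadj hd hvQ
      · refine Or.inl ⟨Or.inl ((h _).2 (by rw [(hz _).1 hp])), ?_⟩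
        rintro ⟨w, hw, he⟩
        rcases Sym2.eq_iff.1 he with ⟨h1, -⟩ | ⟨h1, -⟩
        · exact hvQ (by rw [Sum.inr.inj h1]; exact Finset.mem_insert_self _ _)
        · exact hm (h1 ▸ hw)
      · exact Or.inr ⟨_, hm, by rw [(hz _).1 hp, hzC]; exact Sym2.eq_swap⟩
  constructor
  · rintro (⟨h | h, hn⟩ | ⟨w, hw, he⟩)
    · exact fwd x y h hn
    · exact (fwd y x h (by rwa [Sym2.eq_swap])).symm
    · rcases Sym2.eq_iff.1 he with ⟨h1, h2⟩ | ⟨h1, h2⟩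
      · exact Or.inr (fwd2 x y h1 (h2 ▸ hw))
      · exact Or.inl (fwd2 y x h2 (h1 ▸ hw))
  · rintro (h | h)
    · exact bwd x y h
    · have := bwd y x h
      rwa [or_comm (a := Par G C r (exchange C c d y) _),
        Sym2.eq_swap (a := exchange C c d y)] at this

theorem mem_verts_exchange {x : Finset V ⊕ V} (hc : c ∉ C) (hd : d ∈ C) :
    (x = Sum.inl (insert c (C.erase d)) ∨ ∃ v ∉ insert c (C.erase d), x = Sum.inr v) ↔
      (exchange C c d x = Sum.inl C ∨ ∃ v ∉ C, exchange C c d x = Sum.inr v) := by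
  have inj := (exchange C c d).injective
  have hcd : c ≠ d := fun e => hc (e ▸ hd)
  constructor
  · rintro (rfl | ⟨v, hv, rfl⟩)
    · exact Or.inr ⟨c, hc, exchange_root hc hd⟩
    · by_cases hvd : v = d
      · subst hvd
        exact Or.inl (exchange_first hc hd)
      · simp only [Finset.mem_insert, Finset.mem_erase, not_or, not_and] at hv
        exact Or.inr ⟨v, hv.2 hvd, exchange_of_ne hv.1 hvd⟩
  · rintro (h | ⟨v, hv, h⟩)
    · rw [← exchange_first hc hd] at h
      exact Or.inr ⟨d, by simp [hcd.symm], inj h⟩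
    · by_cases hvc : v = c
      · subst hvc
        rw [← exchange_root hc hd] at h
        exact Or.inl (inj h)
      · have hvd : v ≠ d := fun e => hv (e ▸ hd)
        rw [← exchange_of_ne (C := C) hvc hvd] at h
        exact Or.inr ⟨v, by simp [hvc, hv], inj h⟩

end Exchange
end KTree

/-! ### The Kelmans operation between the two characteristic trees. -/

theorem mainTheorem6 {V : Type*} [Fintype V] [DecidableEq V] (k : ℕ) (hk : 1 ≤ k)
    (T : SimpleGraph V) (hT : KTree.IsKTree T k)
    (hnontriv : ¬ Nonempty (T ≃g (⊤ : SimpleGraph (Fin k))))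
    (C₁ C₂ : Finset V) (hadj : KTree.AdjacentCliques T k C₁ C₂)
    (c₂ : V) (hc₂ : c₂ ∈ C₂ \ C₁) :
    ∃ (hC : Sum.inl C₁ ∈ (KTree.charTree T k C₁).verts)
      (hc : Sum.inr c₂ ∈ (KTree.charTree T k C₁).verts)
      (T' : SimpleGraph (KTree.charTree T k C₁).verts),
      KTree.IsPartialKelmans (KTree.charTree T k C₁).coe ⟨Sum.inr c₂, hc⟩ ⟨Sum.inl C₁, hC⟩ T' ∧
      T'.IsTree ∧
      Nonempty ((KTree.charTree T k C₂).coe ≃g T') := by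
  obtain ⟨hC₁, hC₂, -, Q, hQ, h₁Q, h₂Q⟩ := hadj
  obtain ⟨rfl, d, hd, rfl⟩ := KTree.exists_eq_insert_erase hC₁.card_eq hC₂.card_eq hQ.card_eq
    h₁Q h₂Q hc₂
  have hc := (Finset.mem_sdiff.1 hc₂).2
  have hcd : c₂ ≠ d := fun e => hc (e ▸ hd)
  have hcadj : ∀ w ∈ C₁, T.Adj c₂ w := fun w hw =>
    hQ.isClique (Finset.mem_insert_self _ _) (Finset.mem_insert_of_mem hw)
      fun e => hc (e ▸ hw)
  obtain ⟨r₀, hr₀⟩ := KTree.IsKTreeOn.exists_order hT C₁ (Finset.subset_univ _) hC₁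
  obtain ⟨r, ho, hrc⟩ := hr₀.exists_rank_eq_one (Finset.mem_univ c₂) hc hcadj
  have ho' := ho.swap (Finset.mem_univ c₂) hrc hcadj hd
  have hd' : d ∉ insert c₂ (C₁.erase d) := by simp [hcd.symm]
  have hv := fun a => KTree.mem_charTree_verts hk ho hT hc (a := a)
  have hv' := fun a => KTree.mem_charTree_verts hk ho' hT hd' (a := a)
  have hCv := (hv (Sum.inl C₁)).2 (Or.inl rfl)
  have hcv := (hv (Sum.inr c₂)).2 (Or.inr ⟨c₂, hc, rfl⟩)
  let W : Set (KTree.charTree T k C₁).verts := {x | x.1 ∈ KTree.moved T C₁ r c₂ d}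
  have hWv : ∀ x ∈ KTree.moved T C₁ r c₂ d, x ∈ (KTree.charTree T k C₁).verts := by
    rintro x ⟨v, rfl, hvQ, -⟩
    exact (hv _).2 (Or.inr ⟨v, fun e => hvQ (Finset.mem_insert_of_mem e), rfl⟩)
  let K : SimpleGraph (KTree.charTree T k C₁).verts :=
    (KTree.charTree T k C₁).coe.deleteEdges {e | ∃ w ∈ W, e = s(⟨Sum.inr c₂, hcv⟩, w)} ⊔
      SimpleGraph.fromEdgeSet {e | ∃ w ∈ W, e = s(⟨Sum.inl C₁, hCv⟩, w)}
  -- Moves edge conditions between the vertex subtype and the ambient type, where `exchange` acts.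
  have hlift : ∀ (u : Finset V ⊕ V) (hu : u ∈ (KTree.charTree T k C₁).verts)
      (a b : (KTree.charTree T k C₁).verts),
      (∃ w ∈ W, s(a, b) = s(⟨u, hu⟩, w)) ↔
        ∃ w ∈ KTree.moved T C₁ r c₂ d, s(a.1, b.1) = s(u, w) := by
    intro u hu a b
    constructor
    · rintro ⟨w, hw, he⟩
      refine ⟨w.1, hw, ?_⟩
      simpa using congrArg (Sym2.map Subtype.val) he
    · rintro ⟨w, hw, he⟩
      refine ⟨⟨w, hWv w hw⟩, hw, Sym2.map.injective Subtype.val_injective ?_⟩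
      simpa using he
  have hKadj : ∀ a b, K.Adj a b ↔
      ((KTree.Par T C₁ r a.1 b.1 ∨ KTree.Par T C₁ r b.1 a.1) ∧
        ¬ (∃ w ∈ KTree.moved T C₁ r c₂ d, s(a.1, b.1) = s(Sum.inr c₂, w)) ∨
      ∃ w ∈ KTree.moved T C₁ r c₂ d, s(a.1, b.1) = s(Sum.inl C₁, w)) := by
    intro a b
    rw [SimpleGraph.sup_adj, SimpleGraph.deleteEdges_adj, SimpleGraph.fromEdgeSet_adj,
      SimpleGraph.Subgraph.coe_adj, KTree.charTree_adj hk ho hT]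
    simp only [Set.mem_ofPred_eq, hlift]
    refine or_congr Iff.rfl (and_iff_left_of_imp ?_)
    rintro ⟨w, hw, he⟩ rfl
    obtain ⟨v, rfl, -⟩ := hw
    rcases Sym2.eq_iff.1 he with ⟨h1, h2⟩ | ⟨h1, h2⟩
    · exact Sum.inl_ne_inr (h1.symm.trans h2)
    · exact Sum.inl_ne_inr (h2.symm.trans h1)
  let e : (KTree.charTree T k (insert c₂ (C₁.erase d))).coe ≃g K :=
    { toEquiv := Equiv.subtypeEquiv (KTree.exchange C₁ c₂ d) fun x => by
        rw [hv, hv']; exact KTree.mem_verts_exchange hc hd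
      map_rel_iff' := by
        intro a b
        rw [hKadj, SimpleGraph.Subgraph.coe_adj, KTree.charTree_adj hk ho' hT]
        exact ho.adj_exchange hrc hcadj hd a.1 b.1 }
  refine ⟨hCv, hcv, K, ⟨W, ?_, rfl⟩, e.isTree_iff.1 (KTree.charTree_isTree hk ho' hT hd'), ⟨e⟩⟩
  -- A moved vertex has `c₂` as its only parent, so it is adjacent to `c₂` and not to the root.
  rintro ⟨x, hxv⟩ ⟨v, rfl, hvQ, hsub, hne, -⟩
  have hvC : v ∉ C₁ := fun h => hvQ (Finset.mem_insert_of_mem h)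
  have hp := fun b => KTree.par_iff_of_parent (b := b) hvC (ho.isParent_first hrc hvC hsub hne)
  refine ⟨?_, ?_⟩
  · rw [SimpleGraph.mem_neighborSet, SimpleGraph.Subgraph.coe_adj, KTree.charTree_adj hk ho hT]
    exact Or.inr ((hp _).2 rfl)
  · rintro (h | h)
    · exact Sum.inr_ne_inl (Subtype.ext_iff.1 h)
    · rw [SimpleGraph.mem_neighborSet, SimpleGraph.Subgraph.coe_adj,
        KTree.charTree_adj hk ho hT] at h
      rcases h with h | h
      · cases h
      · exact Sum.inl_ne_inr ((hp _).1 h)
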